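/- **Model.** A site with height at least $2$ is unstable and may topple: it loses two particles and, according to its label, sends two particles to its left neighbour ($l$), two to its right neighbour ($r$), or one to each neighbour ($s$). Let $\nu$ be a translation-invariant and ergodic probability measure on environments $\zeta\in\{l,r,s\}^{\mathbb Z}$. Assume that $\nu$ is directed, i.e. $\nu(\zeta(0)=r)=0$ or $\nu(\zeta(0)=l)=0$, and that for all $x\in\mathbb Z$ $$\nu(\zeta(x)=\zeta(x+1)=s)=0\quad\text{and}\quad \nu(\zeta(x)=\zeta(x+2)=s)=0 .$$ Put $f_r=\nu(\zeta(0)\ne s)$ (which equals $\nu(\zeta(0)=r)$ when the label $l$ has probability zero). *Stationary density.* Let $\mu$ be a probability measure on $\{0,1\}^{\mathbb N}$. On $I_n=\{0,\dots,n\}$ start from the restriction to $I_n$ of a sample of $\mu$, in the environment given by the restriction to $I_n$ of an independent sample of $\nu$; at each time step add one particle at an independent, uniformly chosen site of $I_n$ and topple unstable sites until the configuration is stable (all heights are $0$ or $1$); particles sent outside $I_n$ are lost. Let $\rho_n^t$ be the expected fraction of sites of $I_n$ with height $1$ at time $t$, and $\rho_s=\rho_s(\mu,\nu)=\lim_{n\to\infty}\lim_{t\to\infty}\rho_n^t$.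 *Transition density.* On $\mathbb Z$ let the initial heights $\eta$ have law $\mu_\rho$, the product of Poisson measures with parameter $\rho\ge 0$, independent of $\zeta\sim\nu$; at each time step all unstable sites topple once. The state $(\eta,\zeta)$ is stabilizable if every site topples only finitely often. Let $\rho_{tr}=\sup\{\rho\ge 0: (\eta,\zeta)\text{ is stabilizable }(\mu_\rho\times\nu)\text{-a.s.}\}$. **Theorem.** Under these assumptions: (a) for every $\mu$, the limit $\lim_{t\to\infty}\rho_n^t$ exists for every $n\ge 1$, the limit $\rho_s$ exists, and $\rho_s=1-\frac{f_r}{2}$; (b) $\rho_{tr}$ is finite and is the unique solution $\rho\ge 0$ of $$\rho-\tfrac12\bigl(1-e^{-2\rho}\bigr)=\tfrac{1-f_r}{2}\bigl(1+e^{-2\rho}\bigr)^2 .$$ In particular, $\rho_s\neq\rho_{tr}$. -/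

import Mathlib

open MeasureTheory ProbabilityTheory Filter Topology

namespace Sandpile

/-- Toppling labels: left, right, symmetric. -/
inductive Label : Type
  | l : Label
  | r : Label
  | s : Label
  deriving DecidableEq

instance : MeasurableSpace Label := ⊤

/-- `a.sent d` is the number of particles which a toppling of type `a` at a site `x` sends to the
site `x + d`. -/
def Label.sent : Label → ℤ → ℕ
  | Label.l, d => if d = -1 then 2 else 0
  | Label.r, d => if d = 1 then 2 else 0
  | Label.s, d => if d = -1 ∨ d = 1 then 1 else 0

/-! ### Driven model on the interval `I_n = {0, …, n}` -/

/-- Height configuration after one toppling of the site `x` on `{0, …, n}`, in the environment `ζ`;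
particles sent outside the interval are lost. -/
def topple {n : ℕ} (ζ : Fin (n + 1) → Label) (η : Fin (n + 1) → ℕ) (x : Fin (n + 1)) :
    Fin (n + 1) → ℕ :=
  fun y => (η y - if y = x then 2 else 0) + (ζ x).sent ((y : ℤ) - (x : ℤ))

/-- `ξ` results from `η` by one legal toppling, i.e. the toppling of an unstable site. -/
def LegalTopple {n : ℕ} (ζ : Fin (n + 1) → Label) (η ξ : Fin (n + 1) → ℕ) : Prop :=
  ∃ x, 2 ≤ η x ∧ ξ = topple ζ η x

/-- All sites have height `0` or `1`. -/
def IsStable {n : ℕ} (η : Fin (n + 1) → ℕ) : Prop := ∀ x, η x ≤ 1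

/-- `ξ` is a stable configuration reached from `η` by finitely many legal topplings. -/
def StabilizesTo {n : ℕ} (ζ : Fin (n + 1) → Label) (η ξ : Fin (n + 1) → ℕ) : Prop :=
  Relation.ReflTransGen (LegalTopple ζ) η ξ ∧ IsStable ξ

/-- Abelian property: the stable configuration does not depend on the order of the topplings. -/
theorem StabilizesTo.unique {n : ℕ} {ζ : Fin (n + 1) → Label} {η ξ ξ' : Fin (n + 1) → ℕ}
    (h : StabilizesTo ζ η ξ) (h' : StabilizesTo ζ η ξ') : ξ = ξ' := by
  have stuck : ∀ {a b : Fin (n + 1) → ℕ}, IsStable a →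
      Relation.ReflTransGen (LegalTopple ζ) a b → a = b := by
    intro a b ha hab
    rcases Relation.ReflTransGen.cases_head hab with e | ⟨c, ⟨x, hx, _⟩, _⟩
    · exact e
    · have := ha x
      omega
  obtain ⟨d, h1, h2⟩ := Relation.church_rosser (r := LegalTopple ζ) (by
    rintro a b c ⟨x, hx, rfl⟩ ⟨y, hy, rfl⟩
    by_cases hxy : x = y
    · subst hxy
      exact ⟨_, Relation.ReflGen.refl, Relation.ReflTransGen.refl⟩
    · refine ⟨topple ζ (topple ζ a x) y, Relation.ReflGen.single ⟨y, ?_, rfl⟩,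
        Relation.ReflTransGen.single ⟨x, ?_, ?_⟩⟩
      · simp only [topple, if_neg (Ne.symm hxy)]
        omega
      · simp only [topple, if_neg hxy]
        omega
      · funext z
        simp only [topple]
        by_cases hzx : z = x
        · subst hzx
          simp only [if_neg hxy, if_true]
          omega
        · by_cases hzy : z = y
          · subst hzy
            simp only [if_neg hzx, if_true]
            omega
          · simp only [if_neg hzx, if_neg hzy]
            omega) h.1 h'.1
  rw [stuck h.2 h1, stuck h'.2 h2]

open Classical in
/-- The stabilization of `η` in the environment `ζ`. In environments in which `η` cannot be
stabilized (which need both a label `l` and a label `r`) the value is irrelevant, and set to `η`. -/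
noncomputable def stabilize {n : ℕ} (ζ : Fin (n + 1) → Label) (η : Fin (n + 1) → ℕ) :
    Fin (n + 1) → ℕ :=
  if h : ∃ ξ, StabilizesTo ζ η ξ then h.choose else η

/-- The driven process: the configuration at time `t` when the initial configuration is `η` and the
successive additions take place at the sites `a 0, …, a (t - 1)`; after each addition the
configuration is stabilized. -/
noncomputable def drivenConfig {n : ℕ} (ζ : Fin (n + 1) → Label) (η : Fin (n + 1) → ℕ) :
    (t : ℕ) → (Fin t → Fin (n + 1)) → Fin (n + 1) → ℕ
  | 0, _ => η
  | t + 1, a =>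
      stabilize ζ (drivenConfig ζ η t (fun i => a i.castSucc) + Pi.single (a (Fin.last t)) 1)

/-- Fraction of the sites of `{0, …, n}` whose height is `1`. -/
noncomputable def occupiedFraction {n : ℕ} (η : Fin (n + 1) → ℕ) : ℝ :=
  ((Finset.univ.filter fun x => η x = 1).card : ℝ) / (n + 1)

/-- `ρ_n^t(μ, ν)`: the expected fraction of sites of `{0, …, n}` with height `1` at time `t`. The
initial configuration and the environment are the restrictions to `{0, …, n}` of independent samples
from `μ` and `ν`, and the first `t` addition sites are uniform on `{0, …, n}^t`. -/
noncomputable def expectedDensity (μ : Measure (ℕ → Fin 2)) (ν : Measure (ℤ → Label)) (n t : ℕ) :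
    ℝ :=
  ∫ p : (ℕ → Fin 2) × (ℤ → Label),
    (∑ a : Fin t → Fin (n + 1),
      occupiedFraction (drivenConfig (fun x : Fin (n + 1) => p.2 ((x : ℕ) : ℤ))
        (fun x : Fin (n + 1) => (p.1 (x : ℕ) : ℕ)) t a)) / ((n : ℝ) + 1) ^ t
    ∂(μ.prod ν)

/-- `ρ_s(μ, ν)` exists and equals `ρ`: the iterated limit `lim_{n → ∞} lim_{t → ∞} ρ_n^t` exists and
equals `ρ`. (On the one-point interval, `n = 0`, the process alternates deterministically between
the heights `0` and `1`, so the inner limit is required for `n ≥ 1`.) -/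
def IsStationaryDensity (μ : Measure (ℕ → Fin 2)) (ν : Measure (ℤ → Label)) (ρ : ℝ) : Prop :=
  ∃ L : ℕ → ℝ, (∀ n, 1 ≤ n → Tendsto (fun t => expectedDensity μ ν n t) atTop (𝓝 (L n))) ∧
    Tendsto L atTop (𝓝 ρ)

/-! ### Infinite volume model on `ℤ` -/

/-- One step of the parallel dynamics on `ℤ`: every unstable site topples once. -/
def parallelStep (ζ : ℤ → Label) (η : ℤ → ℕ) : ℤ → ℕ := fun x =>
  (η x - if 2 ≤ η x then 2 else 0)
    + (if 2 ≤ η (x - 1) then (ζ (x - 1)).sent 1 else 0)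
    + (if 2 ≤ η (x + 1) then (ζ (x + 1)).sent (-1) else 0)

/-- The state `(η, ζ)` is stabilizable: every site topples only finitely many times. -/
def Stabilizable (η : ℤ → ℕ) (ζ : ℤ → Label) : Prop :=
  ∀ x : ℤ, {t : ℕ | 2 ≤ ((parallelStep ζ)^[t] η) x}.Finite

/-- The product over `ℤ` of Poisson measures with parameter `ρ`. -/
noncomputable def poissonField (ρ : NNReal) : Measure (ℤ → ℕ) :=
  Measure.infinitePi fun _ : ℤ => poissonMeasure ρ

/-- The parameters `ρ ≥ 0` for which `(η, ζ)` is stabilizable almost surely under `μ_ρ × ν`. -/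
def stabilizingParameters (ν : Measure (ℤ → Label)) : Set ℝ :=
  {ρ | 0 ≤ ρ ∧ ∀ᵐ p ∂((poissonField ρ.toNNReal).prod ν), Stabilizable p.1 p.2}

/-- `ρ_tr(ν) = ρ`: the set of parameters `ρ` with almost sure stabilization has supremum `ρ`. -/
def IsTransitionDensity (ν : Measure (ℤ → Label)) (ρ : ℝ) : Prop :=
  IsLUB (stabilizingParameters ν) ρ

/-! ### Conditions on the law of the environment -/

/-- The translation of environments on `ℤ`. -/
def shift (ζ : ℤ → Label) : ℤ → Label := fun x => ζ (x + 1)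

/-- One of the labels `r`, `l` has probability zero. -/
def IsDirected (ν : Measure (ℤ → Label)) : Prop :=
  ν {ζ | ζ 0 = Label.r} = 0 ∨ ν {ζ | ζ 0 = Label.l} = 0

/-- Any two labels `s` are separated by at least two other labels. -/
def IsRestricted (ν : Measure (ℤ → Label)) : Prop :=
  ∀ x : ℤ, ν {ζ | ζ x = Label.s ∧ ζ (x + 1) = Label.s} = 0 ∧
    ν {ζ | ζ x = Label.s ∧ ζ (x + 2) = Label.s} = 0

/-- `f_r`, the density of labels different from `s`. If the label `l` has probability zero, this is
the density of the label `r`. -/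
noncomputable def directedFraction (ν : Measure (ℤ → Label)) : ℝ :=
  ν.real {ζ | ζ 0 ≠ Label.s}

end Sandpile

namespace Sandpile

/-! ### Existence of stabilizations -/

/-! By reflection it suffices to treat environments without the label `l`; write `f = 1 - f_r` for
the density of `s`.

Stationary density. Topplings preserve certain multiplicative functionals of the heights, while
independent uniform additions multiply their mean by a fixed factor of modulus less than one; so
these means tend to zero. A site with no neighbour labelled `s` has a conserved parity, hence
limiting occupation 1/2. The left neighbour of an `s` can never become empty once it is occupied,
hence has limit 1. For the right neighbour of an `s`, the joint parity with the left neighbour is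
conserved; as the latter is eventually occupied, the limit is again 1/2. If the `s` is at the site 0
and has no left neighbour, a fourth root of unity at the `s` replaces the parity. Summing over sites
gives the density 1/2 + `f`/2 (`tendsto_additionMean_limitOccupation`, `sum_limitOccupation`).

Transition density. By the least action principle, stabilizability means that some integer function
dominates all odometers. In a sparse environment this reduces to a queue of pairs travelling right:
each site `x` contributes `η x / 2` pairs, and an `s` whose two neighbours have even heights
destroys one pair, as each neighbour retains one particle (`stabilizable_iff_bddAbove_queue`). The
queue started at minus infinity is almost surely finite or almost surely infinite, by Kolmogorov's
law in the heights and ergodicity in the labels. Stationarity forces the arrival rate to be at most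
the service rate in the first case and at least that in the second. With Poisson heights the two
rates balance exactly at the stated equation, whose difference of sides `transitionGap` is strictly
increasing.

The densities differ because inserting 1/2 + `f`/2 leaves a positive multiple of 1 - `f` (2 + e)
with e < 1, and sparsity gives `f` ≤ 1/3. -/

theorem Label.sent_eq (a : Label) (d : ℤ) :
    a.sent d = (if d = -1 then a.sent (-1) else 0) + (if d = 1 then a.sent 1 else 0) := by
  cases a <;> simp only [Label.sent] <;> split_ifs <;> simp_all

/-- Only an inequality, since particles that leave the interval are still counted on the right, with
the weights of the outer sites -1 and `n + 1`. -/
theorem sum_mul_sent_le {n : ℕ} (g : ℤ → ℕ) (a : Label) (x : Fin (n + 1)) :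
    ∑ y : Fin (n + 1), g y * a.sent ((y : ℤ) - x) ≤
      g (x - 1) * a.sent (-1) + g (x + 1) * a.sent 1 := by
  have hinj : Function.Injective (fun y : Fin (n + 1) => ((y : ℕ) : ℤ)) := by
    intro y z h
    exact Fin.ext (by simpa using h)
  calc ∑ y : Fin (n + 1), g y * a.sent ((y : ℤ) - x)
      = ∑ z ∈ Finset.univ.map ⟨fun y : Fin (n + 1) => ((y : ℕ) : ℤ), hinj⟩,
          g z * a.sent (z - x) := by simp
    _ ≤ ∑ z ∈ Finset.Icc (-1 : ℤ) (n + 1), g z * a.sent (z - x) := by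
        refine Finset.sum_le_sum_of_subset ?_
        intro z hz
        simp only [Finset.mem_map, Finset.mem_univ, true_and, Function.Embedding.coeFn_mk] at hz
        obtain ⟨y, rfl⟩ := hz
        simp only [Finset.mem_Icc]
        omega
    _ = g (x - 1) * a.sent (-1) + g (x + 1) * a.sent 1 := by
        have hx := x.2
        have h1 : ∀ z : ℤ, g z * a.sent (z - x) =
            (if z = (x : ℤ) - 1 then g (x - 1) * a.sent (-1) else 0) +
            (if z = (x : ℤ) + 1 then g (x + 1) * a.sent 1 else 0) := by
          intro z
          rw [Label.sent_eq, mul_add]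
          congr 1
          · by_cases h : z = (x : ℤ) - 1
            · subst h; simp
            · rw [if_neg h, if_neg (by omega), mul_zero]
          · by_cases h : z = (x : ℤ) + 1
            · subst h; simp
            · rw [if_neg h, if_neg (by omega), mul_zero]
        simp only [h1, Finset.sum_add_distrib, Finset.sum_ite_eq', Finset.mem_Icc]
        rw [if_pos (by omega), if_pos (by omega)]

/-- A weight which is strictly decreased by every toppling of a site with a label other than `l`. -/
def toppleWeight (n : ℕ) (z : ℤ) : ℕ := ((n + 2) ^ 2 - (z + 1) ^ 2 : ℤ).toNat

/-- The weight is decreasing on the sites, which handles `r`, and strictly concave with second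
difference -2, which handles `s`. It is nonnegative up to the outer sites -1 and `n + 1`, so `toNat`
truncates nothing. -/
theorem toppleWeight_mul_sent_lt {n : ℕ} {a : Label} (ha : a ≠ Label.l) (x : Fin (n + 1)) :
    toppleWeight n (x - 1) * a.sent (-1) + toppleWeight n (x + 1) * a.sent 1 <
      toppleWeight n x * 2 := by
  have hx : ((x : ℕ) : ℤ) + 1 ≤ n + 1 := by have := x.2; omega
  have hx0 : (0 : ℤ) ≤ (x : ℕ) := by omega
  have h1 : (toppleWeight n x : ℤ) = (n + 2) ^ 2 - (x + 1) ^ 2 :=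
    Int.toNat_of_nonneg (by nlinarith)
  have h2 : (toppleWeight n (x - 1) : ℤ) = (n + 2) ^ 2 - (x - 1 + 1) ^ 2 :=
    Int.toNat_of_nonneg (by nlinarith)
  have h3 : (toppleWeight n (x + 1) : ℤ) = (n + 2) ^ 2 - (x + 1 + 1) ^ 2 :=
    Int.toNat_of_nonneg (by nlinarith)
  zify
  rw [h1, h2, h3]
  cases a
  · exact absurd rfl ha
  · simp [Label.sent]; nlinarith
  · simp [Label.sent]; nlinarith

theorem sum_mul_topple_lt {n : ℕ} {ζ : Fin (n + 1) → Label} (hζ : ∀ x, ζ x ≠ Label.l)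
    {η : Fin (n + 1) → ℕ} {x : Fin (n + 1)} (hx : 2 ≤ η x) :
    ∑ y : Fin (n + 1), toppleWeight n y * topple ζ η x y <
      ∑ y : Fin (n + 1), toppleWeight n y * η y := by
  have h1 : ∑ y : Fin (n + 1), toppleWeight n y * η y =
      ∑ y : Fin (n + 1), toppleWeight n y * (η y - if y = x then 2 else 0) +
        toppleWeight n x * 2 := by
    have : ∀ y : Fin (n + 1), toppleWeight n y * η y =
        toppleWeight n y * (η y - if y = x then 2 else 0) +
          if y = x then toppleWeight n x * 2 else 0 := by
      intro y
      by_cases h : y = x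
      · subst h
        simp only [if_true, ← mul_add]
        congr 1
        omega
      · simp [h]
    rw [Finset.sum_congr rfl fun y _ => this y, Finset.sum_add_distrib]
    simp
  rw [h1]
  simp only [topple, mul_add, Finset.sum_add_distrib]
  gcongr
  exact (sum_mul_sent_le _ _ _).trans_lt (toppleWeight_mul_sent_lt (hζ x) x)

theorem exists_stabilizesTo {n : ℕ} {ζ : Fin (n + 1) → Label} (hζ : ∀ x, ζ x ≠ Label.l)
    (η : Fin (n + 1) → ℕ) : ∃ ξ, StabilizesTo ζ η ξ := by
  induction h : ∑ y : Fin (n + 1), toppleWeight n y * η y using Nat.strong_induction_on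
    generalizing η with
  | _ k ih =>
    by_cases hs : IsStable η
    · exact ⟨η, Relation.ReflTransGen.refl, hs⟩
    · simp only [IsStable, not_forall, not_le] at hs
      obtain ⟨x, hx⟩ := hs
      obtain ⟨ξ, h1, h2⟩ := ih _ (h ▸ sum_mul_topple_lt hζ hx) _ rfl
      exact ⟨ξ, h1.head ⟨x, hx, rfl⟩, h2⟩

theorem stabilizesTo_stabilize {n : ℕ} {ζ : Fin (n + 1) → Label} {η : Fin (n + 1) → ℕ}
    (h : ∃ ξ, StabilizesTo ζ η ξ) : StabilizesTo ζ η (stabilize ζ η) := by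
  rw [stabilize, dif_pos h]
  exact h.choose_spec

theorem isStable_drivenConfig {n : ℕ} {ζ : Fin (n + 1) → Label} (hζ : ∀ x, ζ x ≠ Label.l)
    {η : Fin (n + 1) → ℕ} (hη : IsStable η) :
    ∀ (t : ℕ) (a : Fin t → Fin (n + 1)), IsStable (drivenConfig ζ η t a)
  | 0, _ => hη
  | _ + 1, _ => (stabilizesTo_stabilize (exists_stabilizesTo hζ _)).2

/-! ### Multiplicative invariants of the topplings -/

/-- The multiplicative functional with weight `α` at `a` and weight `β` at `b`. -/
noncomputable def pairChar {n : ℕ} (a b : Fin (n + 1)) (α β : ℂ) (η : Fin (n + 1) → ℕ) : ℂ :=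
  α ^ η a * β ^ η b

/-- `pairChar a b α β` is preserved by all legal topplings. -/
def IsPairInvariant {n : ℕ} (ζ : Fin (n + 1) → Label) (a b : Fin (n + 1)) (α β : ℂ) : Prop :=
  ∀ x, α ^ (ζ x).sent ((a : ℤ) - x) * β ^ (ζ x).sent ((b : ℤ) - x) =
    α ^ (if a = x then 2 else 0) * β ^ (if b = x then 2 else 0)

theorem IsPairInvariant.topple {n : ℕ} {ζ : Fin (n + 1) → Label} {a b : Fin (n + 1)} {α β : ℂ}
    (h : IsPairInvariant ζ a b α β) {η : Fin (n + 1) → ℕ} {x : Fin (n + 1)} (hx : 2 ≤ η x) :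
    pairChar a b α β (topple ζ η x) = pairChar a b α β η := by
  have key : ∀ y, η y = (η y - if y = x then 2 else 0) + if y = x then 2 else 0 := by
    intro y
    split_ifs with hy
    · subst hy; omega
    · simp
  have h1 : pairChar a b α β η =
      α ^ (η a - if a = x then 2 else 0) * β ^ (η b - if b = x then 2 else 0) *
        (α ^ (if a = x then 2 else 0) * β ^ (if b = x then 2 else 0)) := by
    rw [pairChar]
    conv_lhs => rw [key a, key b]
    rw [pow_add, pow_add]
    ring
  rw [h1, ← h x, pairChar]
  simp only [Sandpile.topple, pow_add]
  ring

theorem IsPairInvariant.stabilizesTo {n : ℕ} {ζ : Fin (n + 1) → Label} {a b : Fin (n + 1)}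
    {α β : ℂ} (h : IsPairInvariant ζ a b α β) {η ξ : Fin (n + 1) → ℕ} (hs : StabilizesTo ζ η ξ) :
    pairChar a b α β ξ = pairChar a b α β η := by
  obtain ⟨hs, -⟩ := hs
  induction hs with
  | refl => rfl
  | tail _ h2 ih =>
    obtain ⟨x, hx, rfl⟩ := h2
    rw [h.topple hx, ih]

theorem IsPairInvariant.drivenConfig {n : ℕ} {ζ : Fin (n + 1) → Label} (hζ : ∀ x, ζ x ≠ Label.l)
    {a b : Fin (n + 1)} {α β : ℂ} (h : IsPairInvariant ζ a b α β) (η : Fin (n + 1) → ℕ) :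
    ∀ (t : ℕ) (z : Fin t → Fin (n + 1)), pairChar a b α β (drivenConfig ζ η t z) =
      pairChar a b α β η * ∏ i, pairChar a b α β (Pi.single (z i) 1)
  | 0, _ => by simp [Sandpile.drivenConfig]
  | t + 1, z => by
    rw [Sandpile.drivenConfig,
      h.stabilizesTo (stabilizesTo_stabilize (exists_stabilizesTo hζ _)), Fin.prod_univ_castSucc,
      ← mul_assoc, ← h.drivenConfig hζ η t]
    simp only [pairChar, Pi.add_apply, pow_add]
    ring

/-- The average over the addition sites of a functional of the driven configuration. -/
noncomputable def additionMean {E : Type*} [AddCommMonoid E] [SMul ℝ E] {n : ℕ}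
    (ζ : Fin (n + 1) → Label) (η : Fin (n + 1) → ℕ) (F : (Fin (n + 1) → ℕ) → E) (t : ℕ) : E :=
  (((n : ℝ) + 1) ^ t)⁻¹ • ∑ a : Fin t → Fin (n + 1), F (drivenConfig ζ η t a)

theorem sum_pairChar_single {n : ℕ} {a b : Fin (n + 1)} (hab : a ≠ b) (α β : ℂ) :
    ∑ z, pairChar a b α β (Pi.single z 1) = n - 1 + α + β := by
  have h1 : ∀ z, pairChar a b α β (Pi.single z 1) =
      1 + (if z = a then α - 1 else 0) + (if z = b then β - 1 else 0) := by
    intro z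
    simp only [pairChar, Pi.single_apply]
    by_cases h : z = a
    · subst h
      simp [hab, Ne.symm hab]
    · by_cases h' : z = b
      · subst h'
        simp [h, Ne.symm h]
      · simp [h, h', Ne.symm h, Ne.symm h']
  rw [Finset.sum_congr rfl fun z _ => h1 z]
  simp only [Finset.sum_add_distrib, Finset.sum_ite_eq', Finset.mem_univ, if_true]
  simp
  ring

/-- Only the additions change the functional, each by a factor depending on its site alone.
Averaging over independent uniform sites gives the `t`-th power of the mean factor. -/
theorem IsPairInvariant.tendsto_additionMean {n : ℕ} {ζ : Fin (n + 1) → Label}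
    (hζ : ∀ x, ζ x ≠ Label.l) {a b : Fin (n + 1)} (hab : a ≠ b) {α β : ℂ}
    (h : IsPairInvariant ζ a b α β) (hlt : ‖(n : ℂ) - 1 + α + β‖ < n + 1)
    (η : Fin (n + 1) → ℕ) :
    Tendsto (additionMean ζ η (pairChar a b α β)) atTop (𝓝 0) := by
  have hn : (0 : ℝ) < (n : ℝ) + 1 := by positivity
  have h1 : additionMean ζ η (pairChar a b α β) = fun t =>
      pairChar a b α β η * (((n : ℂ) - 1 + α + β) / (n + 1)) ^ t := by
    funext t
    simp only [additionMean]
    rw [Finset.sum_congr rfl fun z _ => h.drivenConfig hζ η t z, ← Finset.mul_sum,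
      ← Fintype.sum_pow (fun z => pairChar a b α β (Pi.single z 1)), sum_pairChar_single hab,
      Complex.real_smul, div_pow]
    push_cast
    field_simp
  rw [h1]
  have h2 : Tendsto (fun t : ℕ => (((n : ℂ) - 1 + α + β) / (n + 1)) ^ t) atTop (𝓝 0) := by
    refine tendsto_pow_atTop_nhds_zero_of_norm_lt_one ?_
    have : ‖(n : ℂ) + 1‖ = n + 1 := by
      rw [show (n : ℂ) + 1 = ((n + 1 : ℝ) : ℂ) by push_cast; rfl, Complex.norm_real,
        Real.norm_of_nonneg hn.le]
    rw [norm_div, this, div_lt_one hn]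
    exact hlt
  simpa using h2.const_mul (pairChar a b α β η)

/-! ### Limits of the occupation probabilities -/

/-- No label `l`, and any two labels `s` are separated by at least two other labels. -/
def IsRightSparse {n : ℕ} (ζ : Fin (n + 1) → Label) : Prop :=
  (∀ x, ζ x ≠ Label.l) ∧
    ∀ x y, ζ x = Label.s → ζ y = Label.s → (x : ℕ) < y → (x : ℕ) + 2 < y

/-- The left neighbour `y` of an `s` can lose its particles only by sending two to `x`, which makes
`x` unstable; the later toppling of `x` returns one to `y`. So "`y` occupied or `x` unstable"
persists along the topplings, and in a stable state only the first alternative is left. -/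
theorem one_le_of_stabilizesTo {n : ℕ} {ζ : Fin (n + 1) → Label} (hζ : ∀ x, ζ x ≠ Label.l)
    {x y : Fin (n + 1)} (hx : ζ x = Label.s) (hy : ζ y ≠ Label.s) (hxy : (y : ℕ) + 1 = x)
    {η ξ : Fin (n + 1) → ℕ} (hs : StabilizesTo ζ η ξ) (hη : 1 ≤ η y) : 1 ≤ ξ y := by
  obtain ⟨hs, hst⟩ := hs
  have key : 1 ≤ ξ y ∨ 2 ≤ ξ x := by
    clear hst
    induction hs with
    | refl => exact Or.inl hη
    | @tail b c _ h2 ih =>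
      obtain ⟨z, hz, rfl⟩ := h2
      by_cases hzy : z = y
      · right
        have hyr : ζ y = Label.r := by
          cases h : ζ y with
          | l => exact absurd h (hζ y)
          | r => rfl
          | s => exact absurd h hy
        subst hzy
        simp only [topple, hyr, Label.sent]
        rw [if_pos (by omega : ((x : ℕ) : ℤ) - (z : ℕ) = 1)]
        omega
      · by_cases hzx : z = x
        · left
          subst hzx
          simp only [topple, hx, Label.sent]
          rw [if_pos (by omega : ((y : ℕ) : ℤ) - (z : ℕ) = -1 ∨ ((y : ℕ) : ℤ) - (z : ℕ) = 1)]
          omega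
        · simp only [topple, if_neg (Ne.symm hzy), if_neg (Ne.symm hzx)]
          omega
  have := hst x
  omega

/-- Reduces emptiness of `y` to an event about additions alone, whose probability `(n / (n + 1)) ^
t` is explicit. -/
theorem drivenConfig_eq_zero_imp {n : ℕ} {ζ : Fin (n + 1) → Label} (hζ : ∀ x, ζ x ≠ Label.l)
    {x y : Fin (n + 1)} (hx : ζ x = Label.s) (hy : ζ y ≠ Label.s) (hxy : (y : ℕ) + 1 = x)
    (η : Fin (n + 1) → ℕ) : ∀ (t : ℕ) (a : Fin t → Fin (n + 1)), drivenConfig ζ η t a y = 0 →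
      ∀ i, a i ≠ y
  | 0, _, _ => fun i => i.elim0
  | t + 1, a, h => by
    rw [drivenConfig] at h
    have h1 : ¬ 1 ≤ (drivenConfig ζ η t (fun i => a i.castSucc) +
        (Pi.single (a (Fin.last t)) 1 : Fin (n + 1) → ℕ)) y := by
      intro h1
      have := one_le_of_stabilizesTo hζ hx hy hxy
        (stabilizesTo_stabilize (exists_stabilizesTo hζ _)) h1
      omega
    simp only [Pi.add_apply, Pi.single_apply] at h1
    intro i
    refine Fin.lastCases ?_ (fun j => ?_) i
    · intro h2
      rw [h2] at h1
      simp at h1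
    · exact drivenConfig_eq_zero_imp hζ hx hy hxy η t (fun i => a i.castSucc) (by omega) j

theorem additionMean_mono {n : ℕ} {ζ : Fin (n + 1) → Label} {η : Fin (n + 1) → ℕ}
    {F G : (Fin (n + 1) → ℕ) → ℝ} {t : ℕ}
    (h : ∀ a, F (drivenConfig ζ η t a) ≤ G (drivenConfig ζ η t a)) :
    additionMean ζ η F t ≤ additionMean ζ η G t := by
  simp only [additionMean, smul_eq_mul]
  gcongr
  exact h _

theorem additionMean_congr {E : Type*} [AddCommMonoid E] [SMul ℝ E] {n : ℕ}
    {ζ : Fin (n + 1) → Label} {η : Fin (n + 1) → ℕ}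
    {F G : (Fin (n + 1) → ℕ) → E} {t : ℕ}
    (h : ∀ a, F (drivenConfig ζ η t a) = G (drivenConfig ζ η t a)) :
    additionMean ζ η F t = additionMean ζ η G t := by
  simp only [additionMean, h]

theorem additionMean_const {n : ℕ} (ζ : Fin (n + 1) → Label) (η : Fin (n + 1) → ℕ) (c : ℝ)
    (t : ℕ) : additionMean ζ η (fun _ => c) t = c := by
  simp only [additionMean, Finset.sum_const, Finset.card_univ, Fintype.card_fun, Fintype.card_fin,
    smul_eq_mul, nsmul_eq_mul]
  push_cast
  field_simp

theorem additionMean_add {n : ℕ} (ζ : Fin (n + 1) → Label) (η : Fin (n + 1) → ℕ)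
    (F G : (Fin (n + 1) → ℕ) → ℝ) (t : ℕ) :
    additionMean ζ η (fun h => F h + G h) t = additionMean ζ η F t + additionMean ζ η G t := by
  simp only [additionMean, Finset.sum_add_distrib, smul_add]

theorem additionMean_const_mul {n : ℕ} (ζ : Fin (n + 1) → Label) (η : Fin (n + 1) → ℕ) (c : ℝ)
    (F : (Fin (n + 1) → ℕ) → ℝ) (t : ℕ) :
    additionMean ζ η (fun h => c * F h) t = c * additionMean ζ η F t := by
  simp only [additionMean, ← Finset.mul_sum, smul_eq_mul]
  ring

theorem additionMean_re_mul {n : ℕ} (ζ : Fin (n + 1) → Label) (η : Fin (n + 1) → ℕ) (c : ℂ)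
    (F : (Fin (n + 1) → ℕ) → ℂ) (t : ℕ) :
    additionMean ζ η (fun h => (c * F h).re) t = (c * additionMean ζ η F t).re := by
  simp only [additionMean, ← Complex.re_sum, ← Finset.mul_sum, smul_eq_mul]
  rw [mul_smul_comm, Complex.smul_re, smul_eq_mul]

theorem tendsto_additionMean_eq_zero {n : ℕ} {ζ : Fin (n + 1) → Label} (hζ : ∀ x, ζ x ≠ Label.l)
    {x y : Fin (n + 1)} (hx : ζ x = Label.s) (hy : ζ y ≠ Label.s) (hxy : (y : ℕ) + 1 = x)
    (η : Fin (n + 1) → ℕ) :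
    Tendsto (additionMean ζ η fun h => if h y = 0 then (1 : ℝ) else 0) atTop (𝓝 0) := by
  have hn : (0 : ℝ) < (n : ℝ) + 1 := by positivity
  have h2 : Tendsto (fun t : ℕ => ((n : ℝ) / (n + 1)) ^ t) atTop (𝓝 0) :=
    tendsto_pow_atTop_nhds_zero_of_lt_one (by positivity) (by rw [div_lt_one hn]; linarith)
  refine tendsto_of_tendsto_of_tendsto_of_le_of_le tendsto_const_nhds h2 (fun t => ?_)
    (fun t => ?_)
  · simp only [additionMean, smul_eq_mul]
    refine mul_nonneg (by positivity) (Finset.sum_nonneg fun a _ => ?_)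
    split_ifs <;> norm_num
  · have h3 : ∀ a : Fin t → Fin (n + 1), (if drivenConfig ζ η t a y = 0 then (1 : ℝ) else 0) ≤
        ∏ i, (if a i = y then (0 : ℝ) else 1) := by
      intro a
      split_ifs with h
      · have := drivenConfig_eq_zero_imp hζ hx hy hxy η t a h
        simp [this]
      · exact Finset.prod_nonneg fun i _ => by split_ifs <;> norm_num
    have h4 : ∑ z : Fin (n + 1), (if z = y then (0 : ℝ) else 1) = n := by
      have : ∀ z : Fin (n + 1), (if z = y then (0 : ℝ) else 1) = 1 - if z = y then 1 else 0 := by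
        intro z
        split_ifs <;> norm_num
      simp [this, Finset.sum_sub_distrib]
    simp only [additionMean, smul_eq_mul]
    calc (((n : ℝ) + 1) ^ t)⁻¹ * ∑ a : Fin t → Fin (n + 1),
          (if drivenConfig ζ η t a y = 0 then (1 : ℝ) else 0)
        ≤ (((n : ℝ) + 1) ^ t)⁻¹ * ∑ a : Fin t → Fin (n + 1),
          ∏ i, (if a i = y then (0 : ℝ) else 1) := by
          gcongr with a
          exact h3 a
      _ = ((n : ℝ) / (n + 1)) ^ t := by
          rw [← Fintype.sum_pow (fun z => if z = y then (0 : ℝ) else 1), h4, div_pow]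
          field_simp

/-- The limit of the probability that the site `y` is occupied. -/
noncomputable def limitOccupation {n : ℕ} (ζ : Fin (n + 1) → Label) (y : Fin (n + 1)) : ℝ :=
  open Classical in if ∃ x, ζ x = Label.s ∧ (y : ℕ) + 1 = x then 1 else 1 / 2

theorem tendsto_additionMean_of_forall_not_adjacent {n : ℕ} (hn : 1 ≤ n)
    {ζ : Fin (n + 1) → Label} (hζ : ∀ x, ζ x ≠ Label.l) {η : Fin (n + 1) → ℕ} (hη : IsStable η)
    {y : Fin (n + 1)} (hy : ∀ x, ζ x = Label.s → (x : ℕ) + 1 ≠ y ∧ (y : ℕ) + 1 ≠ x) :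
    Tendsto (additionMean ζ η fun h => if h y = 1 then (1 : ℝ) else 0) atTop (𝓝 (1 / 2)) := by
  -- A second site with trivial weight 1, so that the single-site parity is an instance of
  -- `pairChar`. For `n = 0` the mean factor would be -1 and the parity would oscillate.
  obtain ⟨b, hb⟩ : ∃ b, y ≠ b := by
    have : Nontrivial (Fin (n + 1)) := Fin.nontrivial_iff_two_le.2 (by omega)
    obtain ⟨b, hb⟩ := exists_ne y
    exact ⟨b, hb.symm⟩
  have hinv : IsPairInvariant ζ y b (-1) 1 := by
    intro x
    simp only [one_pow, mul_one]
    have h1 : ∀ k : ℕ, Even k → (-1 : ℂ) ^ k = 1 := fun k hk => hk.neg_one_pow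
    rw [h1 (if y = x then 2 else 0) (by split_ifs <;> decide)]
    apply h1
    cases h : ζ x with
    | l => exact absurd h (hζ x)
    | r => simp only [Label.sent]; split_ifs <;> decide
    | s =>
      have := hy x h
      simp only [Label.sent]
      rw [if_neg (by omega)]
      decide
  have hmean := hinv.tendsto_additionMean hζ hb (by
    have : ‖(n : ℂ) - 1 + -1 + 1‖ = n - 1 := by
      rw [show (n : ℂ) - 1 + -1 + 1 = ((n - 1 : ℝ) : ℂ) by push_cast; ring, Complex.norm_real,
        Real.norm_of_nonneg (by simp; exact_mod_cast hn)]
    rw [this]; linarith) η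
  have h1 : (additionMean ζ η fun h => if h y = 1 then (1 : ℝ) else 0) = fun t =>
      1 / 2 + (-(1 / 2) * additionMean ζ η (pairChar y b (-1) 1) t).re := by
    funext t
    rw [← additionMean_re_mul, ← additionMean_const ζ η (1 / 2) t, ← additionMean_add]
    refine additionMean_congr fun a => ?_
    have := isStable_drivenConfig hζ hη t a y
    simp only [pairChar]
    interval_cases drivenConfig ζ η t a y <;> norm_num
  rw [h1]
  have h2 := (Complex.continuous_re.tendsto _).comp (hmean.const_mul (-(1 / 2)))
  simpa using h2.const_add (1 / 2 : ℝ)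

theorem tendsto_additionMean_one {n : ℕ} {ζ : Fin (n + 1) → Label} (hζ : ∀ x, ζ x ≠ Label.l)
    {η : Fin (n + 1) → ℕ} (hη : IsStable η)
    {x y : Fin (n + 1)} (hx : ζ x = Label.s) (hy : ζ y ≠ Label.s) (hxy : (y : ℕ) + 1 = x) :
    Tendsto (additionMean ζ η fun h => if h y = 1 then (1 : ℝ) else 0) atTop (𝓝 1) := by
  have h1 : (additionMean ζ η fun h => if h y = 1 then (1 : ℝ) else 0) = fun t =>
      1 + -1 * additionMean ζ η (fun h => if h y = 0 then (1 : ℝ) else 0) t := by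
    funext t
    rw [← additionMean_const_mul, ← additionMean_const ζ η 1 t, ← additionMean_add]
    refine additionMean_congr fun a => ?_
    have := isStable_drivenConfig hζ hη t a y
    simp only [additionMean_const]
    interval_cases drivenConfig ζ η t a y <;> norm_num
  rw [h1]
  simpa using ((tendsto_additionMean_eq_zero hζ hx hy hxy η).const_mul (-1)).const_add 1

/-- A toppling of the `s` at 0 removes two particles there and adds one at `y`; the weights `I` and
-1 compensate, since `I ^ 2 = -1`. -/
theorem tendsto_additionMean_right_of_zero {n : ℕ} {ζ : Fin (n + 1) → Label}
    (hζ : IsRightSparse ζ) {η : Fin (n + 1) → ℕ} (hη : IsStable η)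
    {x y : Fin (n + 1)} (hx : ζ x = Label.s) (hx0 : (x : ℕ) = 0) (hxy : (x : ℕ) + 1 = y) :
    Tendsto (additionMean ζ η fun h => if h y = 1 then (1 : ℝ) else 0) atTop (𝓝 (1 / 2)) := by
  have hn : (1 : ℝ) ≤ n := by have := y.2; exact_mod_cast (by omega : 1 ≤ n)
  have hne : x ≠ y := by rintro rfl; omega
  have hinv : IsPairInvariant ζ x y Complex.I (-1) := by
    intro z
    by_cases hzx : z = x
    · subst hzx
      rw [hx]
      simp only [Label.sent, if_true, if_neg (Ne.symm hne)]
      rw [if_neg (by omega), if_pos (by omega)]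
      simp
    · rw [if_neg (Ne.symm hzx)]
      have hzx' : (z : ℕ) ≠ x := fun h => hzx (Fin.ext h)
      cases h : ζ z with
      | l => exact absurd h (hζ.1 z)
      | r =>
        simp only [Label.sent]
        rw [if_neg (by omega), if_neg (by omega)]
        split_ifs <;> simp
      | s =>
        have := hζ.2 x z hx h (by omega)
        simp only [Label.sent]
        rw [if_neg (by omega), if_neg (by omega), if_neg (by rintro rfl; omega)]
  have hmean := hinv.tendsto_additionMean hζ.1 hne (by
    have h1 : ‖(n : ℂ) - 1 + Complex.I + -1‖ ^ 2 = (n - 2) ^ 2 + 1 := by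
      rw [← Complex.normSq_eq_norm_sq, Complex.normSq_apply]
      simp
      ring
    refine lt_of_pow_lt_pow_left₀ 2 (by positivity) ?_
    rw [h1]
    nlinarith) η
  -- The factor 1 - `I` has real part 1, also after multiplication by `I`; hence taking real parts
  -- removes the dependence on the height of `x`, which is 0 or 1.
  have h1 : (additionMean ζ η fun h => if h y = 1 then (1 : ℝ) else 0) = fun t =>
      1 / 2 + (-(1 / 2) * (1 - Complex.I) *
        additionMean ζ η (pairChar x y Complex.I (-1)) t).re := by
    funext t
    rw [← additionMean_re_mul, ← additionMean_const ζ η (1 / 2) t, ← additionMean_add]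
    refine additionMean_congr fun a => ?_
    have hy1 := isStable_drivenConfig hζ.1 hη t a y
    have hx1 := isStable_drivenConfig hζ.1 hη t a x
    simp only [pairChar]
    interval_cases drivenConfig ζ η t a y <;> interval_cases drivenConfig ζ η t a x <;>
      norm_num
  rw [h1]
  have h2 := (Complex.continuous_re.tendsto _).comp
    (hmean.const_mul (-(1 / 2) * (1 - Complex.I)))
  simpa using h2.const_add (1 / 2 : ℝ)

/-- A toppling of `x` flips the parities of `w` and `y` together, so their product is invariant.
When `w` is occupied this product determines `y`; the error is at most the indicator that `w` is
empty, whose mean vanishes in the limit. -/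
theorem tendsto_additionMean_right_of_pos {n : ℕ} {ζ : Fin (n + 1) → Label}
    (hζ : IsRightSparse ζ) {η : Fin (n + 1) → ℕ} (hη : IsStable η)
    {x y w : Fin (n + 1)} (hx : ζ x = Label.s) (hwx : (w : ℕ) + 1 = x) (hxy : (x : ℕ) + 1 = y) :
    Tendsto (additionMean ζ η fun h => if h y = 1 then (1 : ℝ) else 0) atTop (𝓝 (1 / 2)) := by
  have hn : (2 : ℝ) ≤ n := by have := y.2; exact_mod_cast (by omega : 2 ≤ n)
  have hne : w ≠ y := by rintro rfl; omega
  have hw : ζ w ≠ Label.s := by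
    intro h
    have := hζ.2 w x h hx (by omega)
    omega
  have hinv : IsPairInvariant ζ w y (-1) (-1) := by
    intro z
    simp only [← pow_add]
    have h1 : ∀ k : ℕ, Even k → (-1 : ℂ) ^ k = 1 := fun k hk => hk.neg_one_pow
    rw [h1 ((if w = z then 2 else 0) + _) (by split_ifs <;> decide)]
    apply h1
    cases h : ζ z with
    | l => exact absurd h (hζ.1 z)
    | r => simp only [Label.sent]; split_ifs <;> decide
    | s =>
      simp only [Label.sent]
      by_cases hzx : z = x
      · subst hzx
        rw [if_pos (by omega), if_pos (by omega)]
        decide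
      · have hzx' : (z : ℕ) ≠ x := fun h => hzx (Fin.ext h)
        have h2 := hζ.2 x z hx h
        have h3 := hζ.2 z x h hx
        rw [if_neg (by omega), if_neg (by omega)]
        decide
  have hmean := hinv.tendsto_additionMean hζ.1 hne (by
    rw [show (n : ℂ) - 1 + -1 + -1 = ((n - 3 : ℝ) : ℂ) by push_cast; ring, Complex.norm_real,
      Real.norm_eq_abs, abs_lt]
    constructor <;> linarith) η
  have hzero := tendsto_additionMean_eq_zero hζ.1 hx hw hwx η
  have hlim := (Complex.continuous_re.tendsto _).comp (hmean.const_mul (1 / 2))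
  have hlow : Tendsto (fun t => 1 / 2 +
      ((1 / 2 : ℂ) * additionMean ζ η (pairChar w y (-1) (-1)) t).re
      + -1 * additionMean ζ η (fun h => if h w = 0 then (1 : ℝ) else 0) t) atTop (𝓝 (1 / 2)) := by
    simpa using (hlim.const_add (1 / 2 : ℝ)).add (hzero.const_mul (-1))
  have hupp : Tendsto (fun t => 1 / 2 +
      ((1 / 2 : ℂ) * additionMean ζ η (pairChar w y (-1) (-1)) t).re
      + 1 * additionMean ζ η (fun h => if h w = 0 then (1 : ℝ) else 0) t) atTop (𝓝 (1 / 2)) := by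
    simpa using (hlim.const_add (1 / 2 : ℝ)).add (hzero.const_mul 1)
  refine tendsto_of_tendsto_of_tendsto_of_le_of_le hlow hupp (fun t => ?_) (fun t => ?_)
  · dsimp only
    rw [← additionMean_re_mul, ← additionMean_const_mul, ← additionMean_const ζ η (1 / 2) t,
      ← additionMean_add, ← additionMean_add]
    refine additionMean_mono fun a => ?_
    have hy1 := isStable_drivenConfig hζ.1 hη t a y
    have hx1 := isStable_drivenConfig hζ.1 hη t a w
    simp only [pairChar]
    interval_cases drivenConfig ζ η t a y <;> interval_cases drivenConfig ζ η t a w <;>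
      norm_num
  · dsimp only
    rw [← additionMean_re_mul, ← additionMean_const_mul, ← additionMean_const ζ η (1 / 2) t,
      ← additionMean_add, ← additionMean_add]
    refine additionMean_mono fun a => ?_
    have hy1 := isStable_drivenConfig hζ.1 hη t a y
    have hx1 := isStable_drivenConfig hζ.1 hη t a w
    simp only [pairChar]
    interval_cases drivenConfig ζ η t a y <;> interval_cases drivenConfig ζ η t a w <;>
      norm_num

theorem tendsto_additionMean_limitOccupation {n : ℕ} (hn : 1 ≤ n) {ζ : Fin (n + 1) → Label}
    (hζ : IsRightSparse ζ) {η : Fin (n + 1) → ℕ} (hη : IsStable η) (y : Fin (n + 1)) :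
    Tendsto (additionMean ζ η fun h => if h y = 1 then (1 : ℝ) else 0) atTop
      (𝓝 (limitOccupation ζ y)) := by
  rw [limitOccupation]
  split_ifs with h
  · obtain ⟨x, hx, hxy⟩ := h
    refine tendsto_additionMean_one hζ.1 hη hx ?_ hxy
    intro h
    have := hζ.2 y x h hx (by omega)
    omega
  · by_cases h' : ∃ x, ζ x = Label.s ∧ (x : ℕ) + 1 = y
    · obtain ⟨x, hx, hxy⟩ := h'
      rcases Nat.eq_zero_or_pos (x : ℕ) with h0 | h0
      · exact tendsto_additionMean_right_of_zero hζ hη hx h0 hxy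
      · exact tendsto_additionMean_right_of_pos (w := ⟨x - 1, by omega⟩) hζ hη hx
          (by simp only; omega) hxy
    · refine tendsto_additionMean_of_forall_not_adjacent hn hζ.1 hη fun x hx => ⟨?_, ?_⟩
      · exact fun h2 => h' ⟨x, hx, h2⟩
      · exact fun h2 => h ⟨x, hx, h2⟩

theorem tendsto_additionMean_occupiedFraction {n : ℕ} (hn : 1 ≤ n) {ζ : Fin (n + 1) → Label}
    (hζ : IsRightSparse ζ) {η : Fin (n + 1) → ℕ} (hη : IsStable η) :
    Tendsto (additionMean ζ η occupiedFraction) atTop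
      (𝓝 ((∑ y, limitOccupation ζ y) / (n + 1))) := by
  have h1 : additionMean ζ η occupiedFraction = fun t =>
      (∑ y, additionMean ζ η (fun h => if h y = 1 then (1 : ℝ) else 0) t) / (n + 1) := by
    funext t
    simp only [additionMean, occupiedFraction, smul_eq_mul, ← Finset.mul_sum, ← Finset.sum_div]
    rw [Finset.sum_comm]
    simp only [Finset.sum_boole]
    ring
  rw [h1]
  exact (tendsto_finsetSum _ fun y _ =>
    tendsto_additionMean_limitOccupation hn hζ hη y).div_const _

/-! ### Reflection -/

/-- The label seen in a mirror. -/
def Label.flip : Label → Label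
  | Label.l => Label.r
  | Label.r => Label.l
  | Label.s => Label.s

@[simp] theorem Label.flip_flip (a : Label) : a.flip.flip = a := by cases a <;> rfl

@[simp] theorem Label.flip_eq_s {a : Label} : a.flip = Label.s ↔ a = Label.s := by
  cases a <;> simp [Label.flip]

@[simp] theorem Label.flip_eq_l {a : Label} : a.flip = Label.l ↔ a = Label.r := by
  cases a <;> simp [Label.flip]

theorem Label.sent_flip (a : Label) (d : ℤ) : a.flip.sent d = a.sent (-d) := by
  cases a <;> simp only [Label.sent, Label.flip] <;> split_ifs <;> first | rfl | omega

/-- The reflection of an environment on an interval. -/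
def reflectInterval {n : ℕ} (ζ : Fin (n + 1) → Label) : Fin (n + 1) → Label :=
  fun x => (ζ x.rev).flip

@[simp] theorem reflectInterval_reflectInterval {n : ℕ} (ζ : Fin (n + 1) → Label) :
    reflectInterval (reflectInterval ζ) = ζ := by
  funext x
  simp [reflectInterval]

theorem topple_reflectInterval {n : ℕ} (ζ : Fin (n + 1) → Label) (η : Fin (n + 1) → ℕ)
    (x : Fin (n + 1)) :
    topple (reflectInterval ζ) (η ∘ Fin.rev) x.rev = topple ζ η x ∘ Fin.rev := by
  funext y
  simp only [topple, reflectInterval, Function.comp_apply, Fin.rev_rev, Label.sent_flip,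
    Fin.rev_eq_iff]
  have : -((y : ℤ) - (x.rev : ℕ)) = (y.rev : ℕ) - (x : ℕ) := by
    simp only [Fin.val_rev]
    have := x.2
    have := y.2
    omega
  rw [this]

theorem StabilizesTo.reflectInterval {n : ℕ} {ζ : Fin (n + 1) → Label} {η ξ : Fin (n + 1) → ℕ}
    (h : StabilizesTo ζ η ξ) :
    StabilizesTo (reflectInterval ζ) (η ∘ Fin.rev) (ξ ∘ Fin.rev) := by
  refine ⟨h.1.lift (· ∘ Fin.rev) ?_, fun x => h.2 _⟩
  rintro a b ⟨x, hx, rfl⟩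
  exact ⟨x.rev, by simpa using hx, (topple_reflectInterval ζ a x).symm⟩

theorem stabilize_eq {n : ℕ} {ζ : Fin (n + 1) → Label} {η ξ : Fin (n + 1) → ℕ}
    (h : StabilizesTo ζ η ξ) : stabilize ζ η = ξ :=
  (stabilizesTo_stabilize ⟨ξ, h⟩).unique h

theorem stabilize_reflectInterval {n : ℕ} (ζ : Fin (n + 1) → Label) (η : Fin (n + 1) → ℕ) :
    stabilize (reflectInterval ζ) (η ∘ Fin.rev) = stabilize ζ η ∘ Fin.rev := by
  by_cases h : ∃ ξ, StabilizesTo ζ η ξ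
  · exact stabilize_eq (stabilizesTo_stabilize h).reflectInterval
  · have h' : ¬ ∃ ξ, StabilizesTo (reflectInterval ζ) (η ∘ Fin.rev) ξ := by
      rintro ⟨ξ, hξ⟩
      have := hξ.reflectInterval
      rw [reflectInterval_reflectInterval] at this
      refine h ⟨ξ ∘ Fin.rev, ?_⟩
      convert this using 1
      funext x
      simp
    rw [stabilize, dif_neg h', stabilize, dif_neg h]

theorem drivenConfig_reflectInterval {n : ℕ} (ζ : Fin (n + 1) → Label) (η : Fin (n + 1) → ℕ) :
    ∀ (t : ℕ) (a : Fin t → Fin (n + 1)),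
      drivenConfig (reflectInterval ζ) (η ∘ Fin.rev) t (fun i => (a i).rev) =
        drivenConfig ζ η t a ∘ Fin.rev
  | 0, _ => rfl
  | t + 1, a => by
    rw [drivenConfig, drivenConfig, ← stabilize_reflectInterval,
      drivenConfig_reflectInterval ζ η t (fun i => a i.castSucc)]
    congr 1
    funext y
    simp only [Pi.add_apply, Function.comp_apply, Pi.single_apply, Fin.rev_eq_iff]

theorem occupiedFraction_comp_rev {n : ℕ} (η : Fin (n + 1) → ℕ) :
    occupiedFraction (η ∘ Fin.rev) = occupiedFraction η := by
  rw [occupiedFraction, occupiedFraction]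
  congr 2
  exact Finset.card_bij' (fun x _ => x.rev) (fun x _ => x.rev) (by simp) (by simp) (by simp)
    (by simp)

theorem additionMean_reflectInterval {n : ℕ} (ζ : Fin (n + 1) → Label) (η : Fin (n + 1) → ℕ)
    (t : ℕ) : additionMean (reflectInterval ζ) (η ∘ Fin.rev) occupiedFraction t =
      additionMean ζ η occupiedFraction t := by
  have hinv : Function.Involutive fun (a : Fin t → Fin (n + 1)) => fun i => (a i).rev := by
    intro a
    funext i
    simp
  simp only [additionMean]
  congr 1
  rw [← Equiv.sum_comp hinv.toPerm]
  refine Finset.sum_congr rfl fun a _ => ?_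
  rw [Function.Involutive.coe_toPerm, drivenConfig_reflectInterval, occupiedFraction_comp_rev]

/-! ### The stationary density -/

instance : Fintype Label where
  elems := {Label.l, Label.r, Label.s}
  complete a := by cases a <;> decide

instance : DiscreteMeasurableSpace Label := ⟨fun _ => trivial⟩

theorem sum_limitOccupation {n : ℕ} (ζ : Fin (n + 1) → Label) :
    ∑ y, limitOccupation ζ y =
      ((n : ℝ) + 1) / 2 + 1 / 2 * ∑ i : Fin n, if ζ i.succ = Label.s then (1 : ℝ) else 0 := by
  have h1 : limitOccupation ζ (Fin.last n) = 1 / 2 := by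
    rw [limitOccupation, if_neg]
    rintro ⟨x, -, hx⟩
    have := x.2
    simp only [Fin.val_last] at hx
    omega
  have h2 : ∀ i : Fin n, limitOccupation ζ i.castSucc =
      1 / 2 + 1 / 2 * if ζ i.succ = Label.s then (1 : ℝ) else 0 := by
    intro i
    rw [limitOccupation]
    have : (∃ x, ζ x = Label.s ∧ ((i.castSucc : Fin (n + 1)) : ℕ) + 1 = x) ↔
        ζ i.succ = Label.s := by
      constructor
      · rintro ⟨x, hx, hix⟩
        have : x = i.succ := Fin.ext (by simp at hix ⊢; omega)
        rwa [← this]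
      · exact fun h => ⟨i.succ, h, by simp⟩
    simp only [this]
    split_ifs <;> norm_num
  rw [Fin.sum_univ_castSucc, h1, Finset.sum_congr rfl fun i _ => h2 i, Finset.sum_add_distrib,
    ← Finset.mul_sum]
  simp
  ring

/-- Any two labels `s` are separated by at least two other labels. -/
def IsSparse (ζ : ℤ → Label) : Prop :=
  ∀ x, ¬ (ζ x = Label.s ∧ ζ (x + 1) = Label.s) ∧ ¬ (ζ x = Label.s ∧ ζ (x + 2) = Label.s)

theorem IsRestricted.ae_isSparse {ν : Measure (ℤ → Label)} (h : IsRestricted ν) :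
    ∀ᵐ ζ ∂ν, IsSparse ζ := by
  refine ae_all_iff.2 fun x => ?_
  have h1 : ∀ᵐ ζ ∂ν, ¬ (ζ x = Label.s ∧ ζ (x + 1) = Label.s) := by
    rw [ae_iff]
    simpa using (h x).1
  have h2 : ∀ᵐ ζ ∂ν, ¬ (ζ x = Label.s ∧ ζ (x + 2) = Label.s) := by
    rw [ae_iff]
    simpa using (h x).2
  filter_upwards [h1, h2] with ζ h1 h2 using ⟨h1, h2⟩

theorem measurableSet_label (x : ℤ) (a : Label) : MeasurableSet {ζ : ℤ → Label | ζ x = a} := by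
  have h : Measurable fun ζ : ℤ → Label => ζ x := measurable_pi_apply x
  exact h (MeasurableSet.of_discrete (s := {a}))

theorem measure_label_eq {ν : Measure (ℤ → Label)} (hν : MeasurePreserving shift ν ν) (a : Label)
    (x : ℤ) : ν {ζ | ζ x = a} = ν {ζ | ζ 0 = a} := by
  have hstep : ∀ x : ℤ, ν {ζ | ζ (x + 1) = a} = ν {ζ | ζ x = a} := fun x =>
    hν.measure_preimage (measurableSet_label x a).nullMeasurableSet
  induction x using Int.induction_on with
  | zero => rfl
  | succ i ih => rw [hstep, ih]
  | pred i ih => rw [← hstep, sub_add_cancel, ih]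

theorem ae_ne_label {ν : Measure (ℤ → Label)} (hν : MeasurePreserving shift ν ν) {a : Label}
    (h : ν {ζ | ζ 0 = a} = 0) : ∀ᵐ ζ ∂ν, ∀ x, ζ x ≠ a := by
  refine ae_all_iff.2 fun x => ?_
  rw [ae_iff]
  simpa [measure_label_eq hν a x] using h

theorem IsSparse.isRightSparse {ζ : ℤ → Label} (h : IsSparse ζ) (hl : ∀ x, ζ x ≠ Label.l) (n : ℕ) :
    IsRightSparse fun x : Fin (n + 1) => ζ ((x : ℕ) : ℤ) := by
  refine ⟨fun x => hl _, fun x y hx hy hxy => ?_⟩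
  by_contra hlt
  obtain h1 | h1 : ((y : ℕ) : ℤ) = (x : ℕ) + 1 ∨ ((y : ℕ) : ℤ) = (x : ℕ) + 2 := by omega
  · exact (h x).1 ⟨hx, h1 ▸ hy⟩
  · exact (h x).2 ⟨hx, h1 ▸ hy⟩

theorem IsSparse.isRightSparse_reflectInterval {ζ : ℤ → Label} (h : IsSparse ζ)
    (hr : ∀ x, ζ x ≠ Label.r) (n : ℕ) :
    IsRightSparse (reflectInterval fun x : Fin (n + 1) => ζ ((x : ℕ) : ℤ)) := by
  refine ⟨fun x => by simpa [reflectInterval] using hr _, fun x y hx hy hxy => ?_⟩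
  simp only [reflectInterval, Label.flip_eq_s, Fin.val_rev] at hx hy
  by_contra hlt
  have := y.2
  obtain h1 | h1 : ((n + 1 - (x + 1) : ℕ) : ℤ) = (n + 1 - (y + 1) : ℕ) + 1 ∨
    ((n + 1 - (x + 1) : ℕ) : ℤ) = (n + 1 - (y + 1) : ℕ) + 2 := by omega
  · exact (h _).1 ⟨hy, h1 ▸ hx⟩
  · exact (h _).2 ⟨hy, h1 ▸ hx⟩

theorem additionMean_occupiedFraction_mem_Icc {n : ℕ} (ζ : Fin (n + 1) → Label)
    (η : Fin (n + 1) → ℕ) (t : ℕ) : additionMean ζ η occupiedFraction t ∈ Set.Icc (0 : ℝ) 1 := by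
  have h0 : ∀ h : Fin (n + 1) → ℕ, 0 ≤ occupiedFraction h := fun h => by
    rw [occupiedFraction]; positivity
  have h1 : ∀ h : Fin (n + 1) → ℕ, occupiedFraction h ≤ 1 := fun h => by
    rw [occupiedFraction, div_le_one (by positivity)]
    have := Finset.card_filter_le Finset.univ fun x => h x = 1
    rw [Finset.card_univ, Fintype.card_fin] at this
    exact_mod_cast this
  constructor
  · rw [← additionMean_const ζ η 0 t]
    exact additionMean_mono fun a => h0 _
  · rw [← additionMean_const ζ η 1 t]
    exact additionMean_mono fun a => h1 _

theorem expectedDensity_eq (μ : Measure (ℕ → Fin 2)) (ν : Measure (ℤ → Label)) (n t : ℕ) :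
    expectedDensity μ ν n t = ∫ p : (ℕ → Fin 2) × (ℤ → Label),
      additionMean (fun x : Fin (n + 1) => p.2 ((x : ℕ) : ℤ))
        (fun x : Fin (n + 1) => (p.1 (x : ℕ) : ℕ)) occupiedFraction t ∂(μ.prod ν) := by
  rw [expectedDensity]
  congr 1
  funext p
  rw [additionMean, smul_eq_mul, div_eq_inv_mul]

/-- Although `stabilize` is defined by choice, measurability is free: only finitely many discrete
coordinates enter. -/
theorem measurable_comp_restrict {n : ℕ}
    (F : (Fin (n + 1) → Fin 2) → (Fin (n + 1) → Label) → ℝ) :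
    Measurable fun p : (ℕ → Fin 2) × (ℤ → Label) =>
      F (fun x : Fin (n + 1) => p.1 x) (fun x : Fin (n + 1) => p.2 ((x : ℕ) : ℤ)) := by
  have h1 : Measurable (Function.uncurry F) := Measurable.of_discrete
  have h2 : Measurable fun p : (ℕ → Fin 2) × (ℤ → Label) => fun x : Fin (n + 1) => p.1 x :=
    measurable_pi_lambda _ fun x => (measurable_pi_apply _).comp measurable_fst
  have h3 : Measurable fun p : (ℕ → Fin 2) × (ℤ → Label) =>
      fun x : Fin (n + 1) => p.2 ((x : ℕ) : ℤ) :=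
    measurable_pi_lambda _ fun x => (measurable_pi_apply _).comp measurable_snd
  exact h1.comp (h2.prodMk h3)

/-- If almost surely the occupied fraction on `{0, …, n}` has a limit which only counts the labels
`s` at `n` of the sites, the expected limit is determined by the density of labels `s`. -/
theorem tendsto_expectedDensity {ν : Measure (ℤ → Label)} [IsProbabilityMeasure ν]
    (hν : MeasurePreserving shift ν ν) (μ : Measure (ℕ → Fin 2)) [IsProbabilityMeasure μ] (n : ℕ)
    (c : Fin n → ℤ)
    (h : ∀ᵐ ζ ∂ν, ∀ η : Fin (n + 1) → ℕ, IsStable η →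
      Tendsto (additionMean (fun x : Fin (n + 1) => ζ ((x : ℕ) : ℤ)) η occupiedFraction) atTop
        (𝓝 ((((n : ℝ) + 1) / 2 +
          1 / 2 * ∑ i, if ζ (c i) = Label.s then (1 : ℝ) else 0) / (n + 1)))) :
    Tendsto (fun t => expectedDensity μ ν n t) atTop
      (𝓝 (1 / 2 + ν.real {ζ | ζ 0 = Label.s} / 2 * (n / (n + 1)))) := by
  have hlim : ∫ p : (ℕ → Fin 2) × (ℤ → Label), (((n : ℝ) + 1) / 2 +
      1 / 2 * ∑ i, if p.2 (c i) = Label.s then (1 : ℝ) else 0) / (n + 1) ∂(μ.prod ν) =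
      1 / 2 + ν.real {ζ | ζ 0 = Label.s} / 2 * (n / (n + 1)) := by
    have h1 : ∀ i, ∫ ζ : ℤ → Label, (if ζ (c i) = Label.s then (1 : ℝ) else 0) ∂ν =
        ν.real {ζ | ζ 0 = Label.s} := by
      intro i
      have : (fun ζ : ℤ → Label => if ζ (c i) = Label.s then (1 : ℝ) else 0) =
          {ζ : ℤ → Label | ζ (c i) = Label.s}.indicator 1 := by
        funext ζ
        simp [Set.indicator_apply]
      rw [this, integral_indicator_one (measurableSet_label _ _), measureReal_def,
        measure_label_eq hν, measureReal_def]
    have hsint : ∀ i, Integrable (fun ζ : ℤ → Label =>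
        if ζ (c i) = Label.s then (1 : ℝ) else 0) ν := by
      intro i
      refine Integrable.of_bound (C := 1) ?_ (ae_of_all _ fun ζ => ?_)
      · exact (Measurable.ite (measurableSet_label _ _) measurable_const
          measurable_const).aestronglyMeasurable
      · split_ifs <;> simp
    rw [integral_fun_snd (fun ζ : ℤ → Label => (((n : ℝ) + 1) / 2 +
      1 / 2 * ∑ i, if ζ (c i) = Label.s then (1 : ℝ) else 0) / (n + 1)), integral_div,
      integral_add (integrable_const _) ((integrable_finsetSum _ fun i _ => hsint i).const_mul _),
      integral_const_mul, integral_finsetSum _ fun i _ => hsint i]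
    simp only [h1]
    simp
    field_simp
  rw [← hlim]
  simp only [expectedDensity_eq]
  refine tendsto_integral_of_dominated_convergence (fun _ => 1)
    (fun t => (measurable_comp_restrict fun η ζ =>
      additionMean ζ (fun x => (η x : ℕ)) occupiedFraction t).aestronglyMeasurable)
    (integrable_const _)
    (fun t => ae_of_all _ fun p => ?_) ?_
  · have := additionMean_occupiedFraction_mem_Icc (fun x : Fin (n + 1) => p.2 ((x : ℕ) : ℤ))
        (fun x : Fin (n + 1) => (p.1 (x : ℕ) : ℕ)) t
    rw [Real.norm_of_nonneg this.1]
    exact this.2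
  · have h' : ∀ᵐ p ∂(μ.prod ν), _ := Measure.quasiMeasurePreserving_snd.ae h
    filter_upwards [h'] with p hp
    exact hp _ fun x => by omega

theorem isStationaryDensity {ν : Measure (ℤ → Label)} [IsProbabilityMeasure ν]
    (hν : MeasurePreserving shift ν ν) (hdir : IsDirected ν) (hres : IsRestricted ν)
    (μ : Measure (ℕ → Fin 2)) [IsProbabilityMeasure μ] :
    IsStationaryDensity μ ν (1 / 2 + ν.real {ζ | ζ 0 = Label.s} / 2) := by
  refine ⟨fun n => 1 / 2 + ν.real {ζ | ζ 0 = Label.s} / 2 * (n / (n + 1)), fun n hn => ?_, ?_⟩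
  · rcases hdir with h | h
    -- In the mirrored interval the labels counted sit at 0, …, `n - 1` instead of 1, …, `n`; by
    -- stationarity their mean number is the same. Reversing the initial heights is harmless, as the
    -- limit does not depend on them.
    · refine tendsto_expectedDensity hν μ n (fun i => ((i.succ.rev : Fin (n + 1)) : ℕ)) ?_
      filter_upwards [ae_ne_label hν h, hres.ae_isSparse] with ζ h1 h2 η hη
      have := tendsto_additionMean_occupiedFraction hn (h2.isRightSparse_reflectInterval h1 n)
        (η := η ∘ Fin.rev) fun x => hη _
      rw [sum_limitOccupation] at this
      simp only [reflectInterval, Label.flip_eq_s] at this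
      convert this using 1
      funext t
      exact (additionMean_reflectInterval _ _ t).symm
    · refine tendsto_expectedDensity hν μ n (fun i => ((i.succ : Fin (n + 1)) : ℕ)) ?_
      filter_upwards [ae_ne_label hν h, hres.ae_isSparse] with ζ h1 h2 η hη
      have := tendsto_additionMean_occupiedFraction hn (h2.isRightSparse h1 n) hη
      rwa [sum_limitOccupation] at this
  · have := (tendsto_natCast_div_add_atTop (𝕜 := ℝ) 1).const_mul (ν.real {ζ | ζ 0 = Label.s} / 2)
    simpa using this.const_add (1 / 2 : ℝ)

/-! ### Odometers -/

/-- The number of topplings of `x` before time `t` in the parallel dynamics. -/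
def odometer (η : ℤ → ℕ) (ζ : ℤ → Label) (t : ℕ) (x : ℤ) : ℕ :=
  ((Finset.range t).filter fun k => 2 ≤ ((parallelStep ζ)^[k] η) x).card

theorem odometer_succ (η : ℤ → ℕ) (ζ : ℤ → Label) (t : ℕ) (x : ℤ) :
    odometer η ζ (t + 1) x =
      odometer η ζ t x + if 2 ≤ ((parallelStep ζ)^[t] η) x then 1 else 0 := by
  rw [odometer, Finset.range_add_one, Finset.filter_insert]
  split_ifs with h
  · rw [Finset.card_insert_of_notMem (by simp), odometer]
  · rw [odometer, add_zero]

theorem iterate_parallelStep_add (η : ℤ → ℕ) (ζ : ℤ → Label) (t : ℕ) (x : ℤ) :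
    ((parallelStep ζ)^[t] η) x + 2 * odometer η ζ t x =
      η x + odometer η ζ t (x - 1) * (ζ (x - 1)).sent 1 +
        odometer η ζ t (x + 1) * (ζ (x + 1)).sent (-1) := by
  induction t with
  | zero => simp [odometer]
  | succ t ih =>
    simp only [odometer_succ, Function.iterate_succ_apply', parallelStep, add_mul, ite_mul, one_mul,
      zero_mul]
    split_ifs <;> omega

/-- Toppling every site `x` exactly `v x` times, legally or not, leaves heights at most `1`. -/
def IsSuperOdometer (η : ℤ → ℕ) (ζ : ℤ → Label) (v : ℤ → ℕ) : Prop :=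
  ∀ x, η x + v (x - 1) * (ζ (x - 1)).sent 1 + v (x + 1) * (ζ (x + 1)).sent (-1) ≤ 2 * v x + 1

/-- If `x` is unstable, its height is at least 2 while the neighbours have toppled at most `v`
times; mass balance then leaves `x` strictly below `v x`, with room for one more toppling. -/
theorem IsSuperOdometer.odometer_le {η : ℤ → ℕ} {ζ : ℤ → Label} {v : ℤ → ℕ}
    (h : IsSuperOdometer η ζ v) (t : ℕ) : ∀ x, odometer η ζ t x ≤ v x := by
  induction t with
  | zero => intro x; simp [odometer]
  | succ t ih =>
    intro x
    rw [odometer_succ]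
    split_ifs with hx
    · have h1 := iterate_parallelStep_add η ζ t x
      have h2 := h x
      have h3 := Nat.mul_le_mul_right ((ζ (x - 1)).sent 1) (ih (x - 1))
      have h4 := Nat.mul_le_mul_right ((ζ (x + 1)).sent (-1)) (ih (x + 1))
      have h5 := ih x
      omega
    · exact ih x

/-- Least action principle. -/
theorem stabilizable_iff_exists_isSuperOdometer {η : ℤ → ℕ} {ζ : ℤ → Label} :
    Stabilizable η ζ ↔ ∃ v, IsSuperOdometer η ζ v := by
  constructor
  · intro h
    have key : ∀ x, ∃ T, ∀ t, T ≤ t → odometer η ζ t x = (h x).toFinset.card ∧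
        ((parallelStep ζ)^[t] η) x ≤ 1 := by
      intro x
      obtain ⟨T, hT⟩ := (h x).bddAbove
      refine ⟨T + 1, fun t ht => ⟨?_, ?_⟩⟩
      · rw [odometer]
        congr 1
        ext k
        simp only [Finset.mem_filter, Finset.mem_range, Set.Finite.mem_toFinset, Set.mem_ofPred_eq,
          and_iff_right_iff_imp]
        intro hk
        have := hT hk
        omega
      · by_contra hlt
        have := hT (show t ∈ {t : ℕ | 2 ≤ ((parallelStep ζ)^[t] η) x} by
          simp only [Set.mem_ofPred_eq]; omega)
        omega
    choose T hT using key
    refine ⟨fun x => (h x).toFinset.card, fun x => ?_⟩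
    set t := T x + T (x - 1) + T (x + 1) with ht
    have h1 := hT x t (by omega)
    have h2 := hT (x - 1) t (by omega)
    have h3 := hT (x + 1) t (by omega)
    have h4 := iterate_parallelStep_add η ζ t x
    rw [h1.1, h2.1, h3.1] at h4
    have := h1.2
    dsimp only
    omega
  · rintro ⟨v, hv⟩ x
    by_contra hinf
    obtain ⟨S, hS, hcard⟩ := Set.Infinite.exists_subset_card_eq hinf (v x + 1)
    have h1 := hv.odometer_le (S.sup id + 1) x
    have h2 : S.card ≤ odometer η ζ (S.sup id + 1) x := by
      refine Finset.card_le_card fun k hk => ?_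
      simp only [Finset.mem_filter, Finset.mem_range]
      exact ⟨Nat.lt_succ_of_le (Finset.le_sup (f := id) hk), hS hk⟩
    omega

/-- The reflection of an environment on `ℤ`. -/
def reflectEnv (ζ : ℤ → Label) : ℤ → Label := fun x => (ζ (-x)).flip

@[simp] theorem reflectEnv_reflectEnv (ζ : ℤ → Label) : reflectEnv (reflectEnv ζ) = ζ := by
  funext x
  simp [reflectEnv]

theorem Stabilizable.reflect {η : ℤ → ℕ} {ζ : ℤ → Label} (h : Stabilizable η ζ) :
    Stabilizable (fun x => η (-x)) (reflectEnv ζ) := by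
  rw [stabilizable_iff_exists_isSuperOdometer] at h ⊢
  obtain ⟨v, hv⟩ := h
  refine ⟨fun x => v (-x), fun x => ?_⟩
  have := hv (-x)
  simp only [reflectEnv, Label.sent_flip, neg_neg]
  rw [show -(x - 1) = -x + 1 by ring, show -(x + 1) = -x - 1 by ring]
  omega

theorem stabilizable_reflect_iff {η : ℤ → ℕ} {ζ : ℤ → Label} :
    Stabilizable (fun x => η (-x)) (reflectEnv ζ) ↔ Stabilizable η ζ := by
  refine ⟨fun h => ?_, Stabilizable.reflect⟩
  simpa using h.reflect

/-! ### The queue of pairs of particles -/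

/-- Whether the site `x` removes a pair of particles: it has label `s`, and the heights of both
neighbours are even. -/
def service (η : ℤ → ℕ) (ζ : ℤ → Label) (x : ℤ) : ℕ :=
  if ζ x = Label.s ∧ Even (η (x - 1)) ∧ Even (η (x + 1)) then 1 else 0

/-- The number of pairs of particles which leave `x` to the right when the pairs start at the sites
`x - N + 1, …, x`. -/
def queue (η : ℤ → ℕ) (ζ : ℤ → Label) : ℕ → ℤ → ℕ
  | 0, _ => 0
  | N + 1, x => queue η ζ N (x - 1) + η x / 2 - service η ζ x

theorem queue_le_queue_succ (η : ℤ → ℕ) (ζ : ℤ → Label) (N : ℕ) :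
    ∀ x, queue η ζ N x ≤ queue η ζ (N + 1) x := by
  induction N with
  | zero => intro x; exact Nat.zero_le _
  | succ N ih =>
    intro x
    have := ih (x - 1)
    rw [queue, queue]
    omega

theorem queue_monotone (η : ℤ → ℕ) (ζ : ℤ → Label) (x : ℤ) :
    Monotone fun N => queue η ζ N x :=
  monotone_nat_of_le_succ fun N => queue_le_queue_succ η ζ N x

theorem Label.sent_of_ne {a : Label} (hl : a ≠ Label.l) (hs : a ≠ Label.s) :
    a.sent 1 = 2 ∧ a.sent (-1) = 0 := by
  cases a <;> simp_all [Label.sent]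

theorem Label.sent_s : Label.s.sent 1 = 1 ∧ Label.s.sent (-1) = 1 := by
  simp [Label.sent]

/-- It suffices to find a supersolution `W` of the queue recursion; induction on `N` then bounds
every finite queue. -/
theorem IsSuperOdometer.exists_queue_le {η : ℤ → ℕ} {ζ : ℤ → Label} {u : ℤ → ℕ}
    (hu : IsSuperOdometer η ζ u) (hl : ∀ x, ζ x ≠ Label.l) (hζ : IsSparse ζ) :
    ∃ W : ℤ → ℕ, ∀ N x, queue η ζ N x ≤ W x := by
  -- Away from the labels `s` the topplings count departing pairs. At an `s` and at its left
  -- neighbour, `u` also counts pairs bouncing between the two, so there `W` is computed from the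
  -- last value of `u` before them.
  let W : ℤ → ℕ := fun y =>
    if ζ y = Label.s then u (y - 2) + η (y - 1) / 2 + η y / 2 - service η ζ y
    else if ζ (y + 1) = Label.s then u (y - 1) + η y / 2 else u y
  have hW : ∀ y, W y = if ζ y = Label.s then u (y - 2) + η (y - 1) / 2 + η y / 2 - service η ζ y
    else if ζ (y + 1) = Label.s then u (y - 1) + η y / 2 else u y := fun y => rfl
  have step : ∀ y, W (y - 1) + η y / 2 - service η ζ y ≤ W y := by
    intro y
    have hd1 := (hζ (y - 1)).1
    have hd2 := (hζ (y - 1)).2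
    have hd3 := (hζ (y - 2)).1
    rw [show y - 1 + 1 = y by ring] at hd1
    rw [show y - 1 + 2 = y + 1 by ring] at hd2
    rw [show y - 2 + 1 = y - 1 by ring] at hd3
    rw [hW, hW y, show y - 1 + 1 = y by ring, show y - 1 - 2 = y - 3 by ring,
      show y - 1 - 1 = y - 2 by ring]
    by_cases hy : ζ y = Label.s
    · have h1 : ζ (y - 1) ≠ Label.s := fun h => hd1 ⟨h, hy⟩
      rw [if_neg h1, if_pos hy, if_pos hy]
    · have hsv : service η ζ y = 0 := by rw [service, if_neg (fun h => hy h.1)]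
      rw [if_neg hy, if_neg hy, hsv]
      by_cases hy1 : ζ (y + 1) = Label.s
      · have h1 : ζ (y - 1) ≠ Label.s := fun h => hd2 ⟨h, hy1⟩
        rw [if_neg h1, if_pos hy1]
        omega
      · rw [if_neg hy1]
        have u0 := hu y
        have l0 := Label.sent_of_ne (hl y) hy
        have l1 := Label.sent_of_ne (hl _) hy1
        -- Just after an `s`, the inequalities for `u` at `y - 2`, `y - 1` and `y` are combined: in
        -- their sum the middle values of `u` cancel. Taking parities into account, the slack costs
        -- at most one pair, and only if both neighbours of the `s` are even, which is `service`.
        by_cases h1 : ζ (y - 1) = Label.s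
        · rw [if_pos h1]
          have u1 := hu (y - 1)
          have u2 := hu (y - 2)
          have h2 : ζ (y - 2) ≠ Label.s := fun h => hd3 ⟨h, h1⟩
          have h3 : ζ (y - 3) ≠ Label.s := by
            intro h
            have := (hζ (y - 3)).2
            rw [show y - 3 + 2 = y - 1 by ring] at this
            exact this ⟨h, h1⟩
          have l2 := Label.sent_of_ne (hl _) h2
          have l3 := Label.sent_of_ne (hl _) h3
          rw [show y - 1 - 1 = y - 2 by ring, show y - 1 + 1 = y by ring, l2.1, l0.2] at u1
          rw [show y - 2 - 1 = y - 3 by ring, show y - 2 + 1 = y - 1 by ring, l3.1, h1,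
            Label.sent_s.2] at u2
          rw [h1, Label.sent_s.1, l1.2] at u0
          rw [service, show y - 1 - 1 = y - 2 by ring, show y - 1 + 1 = y by ring]
          simp only [h1, true_and, Nat.even_iff]
          split_ifs <;> omega
        · rw [if_neg h1]
          have l2 := Label.sent_of_ne (hl _) h1
          rw [l2.1, l1.2] at u0
          omega
  refine ⟨W, fun N => ?_⟩
  induction N with
  | zero => intro x; exact Nat.zero_le _
  | succ N ih =>
    intro x
    have h1 := ih (x - 1)
    have h2 := step x
    rw [queue]
    omega

/-- The toppling numbers can be read off from the flow of pairs; sparsity makes the corrections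
around different labels `s` independent. -/
theorem exists_isSuperOdometer_of_queue {η : ℤ → ℕ} {ζ : ℤ → Label} (hl : ∀ x, ζ x ≠ Label.l)
    (hζ : IsSparse ζ) {Q : ℤ → ℕ} (hQ : ∀ x, Q x = Q (x - 1) + η x / 2 - service η ζ x) :
    ∃ v, IsSuperOdometer η ζ v := by
  -- Each pair reaching an `s` makes it topple twice, since the left neighbour returns what it is
  -- sent. If that neighbour is even, it retains one particle, which saves one toppling; truncated
  -- subtraction covers the case of no pair.
  let A : ℤ → ℕ := fun y =>
    if Even (η (y - 1)) then 2 * (Q (y - 1) + η y / 2) - 1 else 2 * (Q (y - 1) + η y / 2)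
  -- The left neighbour of an `s` also topples the particles sent back to it, one for each toppling
  -- of the `s`.
  let v : ℤ → ℕ := fun y =>
    if ζ y = Label.s then A y
    else if ζ (y + 1) = Label.s then Q (y - 1) + (η y + A (y + 1)) / 2 else Q y
  have hA : ∀ y, A y = if Even (η (y - 1)) then 2 * (Q (y - 1) + η y / 2) - 1
    else 2 * (Q (y - 1) + η y / 2) := fun y => rfl
  have hv : ∀ y, v y = if ζ y = Label.s then A y
    else if ζ (y + 1) = Label.s then Q (y - 1) + (η y + A (y + 1)) / 2 else Q y := fun y => rfl
  have hQ0 : ∀ x, ζ x ≠ Label.s → Q x = Q (x - 1) + η x / 2 := by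
    intro x hx
    rw [hQ x, service, if_neg (fun h => hx h.1), Nat.sub_zero]
  refine ⟨v, fun y => ?_⟩
  have hd0 := (hζ y).1
  have hd1 := (hζ (y - 1)).1
  have hd2 := (hζ (y - 1)).2
  rw [show y - 1 + 1 = y by ring] at hd1
  rw [show y - 1 + 2 = y + 1 by ring] at hd2
  by_cases hy : ζ y = Label.s
  · have h1 : ζ (y - 1) ≠ Label.s := fun h => hd1 ⟨h, hy⟩
    have h2 : ζ (y + 1) ≠ Label.s := fun h => hd0 ⟨hy, h⟩
    have l1 := Label.sent_of_ne (hl _) h1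
    have l2 := Label.sent_of_ne (hl _) h2
    have hQ1 := hQ0 _ h1
    rw [l1.1, l2.2, hv (y - 1), if_neg h1, show y - 1 + 1 = y by ring, if_pos hy, hv y, if_pos hy,
      hA y]
    simp only [Nat.even_iff]
    split_ifs <;> omega
  · by_cases hy1 : ζ (y + 1) = Label.s
    · have h1 : ζ (y - 1) ≠ Label.s := fun h => hd2 ⟨h, hy1⟩
      have l1 := Label.sent_of_ne (hl _) h1
      rw [l1.1, hy1, Label.sent_s.2, hv (y - 1), if_neg h1, show y - 1 + 1 = y by ring, if_neg hy,
        hv (y + 1), if_pos hy1, hv y, if_neg hy, if_pos hy1]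
      omega
    · have l2 := Label.sent_of_ne (hl _) hy1
      have hQy := hQ0 _ hy
      rw [l2.2, hv y, if_neg hy, if_neg hy1]
      by_cases h1 : ζ (y - 1) = Label.s
      · have hQ1 := hQ (y - 1)
        rw [service, show y - 1 - 1 = y - 2 by ring, show y - 1 + 1 = y by ring] at hQ1
        rw [h1, Label.sent_s.1, hv (y - 1), if_pos h1, hA, show y - 1 - 1 = y - 2 by ring]
        simp only [h1, true_and, Nat.even_iff] at hQ1 ⊢
        split_ifs at hQ1 ⊢ <;> omega
      · have l1 := Label.sent_of_ne (hl _) h1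
        rw [l1.1, hv (y - 1), if_neg h1, show y - 1 + 1 = y by ring, if_neg hy]
        omega

/-- A bounded queue is eventually constant in `N`, by monotonicity and integrality, and its limit
solves the recursion. -/
theorem stabilizable_iff_bddAbove_queue {η : ℤ → ℕ} {ζ : ℤ → Label} (hl : ∀ x, ζ x ≠ Label.l)
    (hζ : IsSparse ζ) :
    Stabilizable η ζ ↔ ∀ x, BddAbove (Set.range fun N => queue η ζ N x) := by
  rw [stabilizable_iff_exists_isSuperOdometer]
  constructor
  · rintro ⟨u, hu⟩ x
    obtain ⟨W, hW⟩ := hu.exists_queue_le hl hζ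
    exact ⟨W x, by rintro _ ⟨N, rfl⟩; exact hW N x⟩
  · intro h
    have key : ∀ x, ∃ q T, ∀ N, T ≤ N → queue η ζ N x = q := by
      intro x
      obtain ⟨T, hT⟩ := Nat.sSup_mem (Set.range_nonempty fun N => queue η ζ N x) (h x)
      refine ⟨_, T, fun N hN => le_antisymm (le_csSup (h x) ⟨N, rfl⟩) ?_⟩
      rw [← hT]
      exact queue_monotone η ζ x hN
    choose Q T hQ using key
    refine exists_isSuperOdometer_of_queue hl hζ (Q := Q) fun x => ?_
    have h1 := hQ x (T x + T (x - 1) + 1) (by omega)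
    have h2 := hQ (x - 1) (T x + T (x - 1)) (by omega)
    rw [← h1, queue, h2]

open scoped ENNReal

/-! ### The stationary queue -/

/-- The stationary queue length, which may be infinite. -/
noncomputable def queueSup (η : ℤ → ℕ) (ζ : ℤ → Label) (x : ℤ) : ℝ≥0∞ :=
  ⨆ N, (queue η ζ N x : ℝ≥0∞)

theorem service_le_one (η : ℤ → ℕ) (ζ : ℤ → Label) (x : ℤ) : service η ζ x ≤ 1 := by
  rw [service]
  split_ifs <;> norm_num

theorem queueSup_add_le (η : ℤ → ℕ) (ζ : ℤ → Label) (x : ℤ) :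
    queueSup η ζ (x - 1) + (η x / 2 : ℕ) ≤ queueSup η ζ x + (service η ζ x : ℝ≥0∞) := by
  rw [queueSup, ENNReal.iSup_add]
  refine iSup_le fun N => ?_
  calc ((queue η ζ N (x - 1) : ℝ≥0∞)) + (η x / 2 : ℕ)
      ≤ (queue η ζ (N + 1) x : ℝ≥0∞) + (service η ζ x : ℝ≥0∞) := by
        rw [queue]
        norm_cast
        omega
    _ ≤ _ := by
        gcongr
        exact le_iSup (fun N => (queue η ζ N x : ℝ≥0∞)) (N + 1)

theorem queueSup_le_add (η : ℤ → ℕ) (ζ : ℤ → Label) (x : ℤ) :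
    queueSup η ζ x ≤ queueSup η ζ (x - 1) + (η x / 2 : ℕ) := by
  refine iSup_le fun N => ?_
  calc (queue η ζ N x : ℝ≥0∞) ≤ (queue η ζ N (x - 1) : ℝ≥0∞) + (η x / 2 : ℕ) := by
        have := queue_le_queue_succ η ζ N x
        rw [queue] at this
        norm_cast
        omega
    _ ≤ _ := by
        gcongr
        exact le_iSup (fun N => (queue η ζ N (x - 1) : ℝ≥0∞)) N

theorem queueSup_sub_one_eq_top_iff (η : ℤ → ℕ) (ζ : ℤ → Label) (x : ℤ) :
    queueSup η ζ (x - 1) = ⊤ ↔ queueSup η ζ x = ⊤ := by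
  constructor
  · intro h
    have := queueSup_add_le η ζ x
    rw [h, top_add, top_le_iff, ENNReal.add_eq_top] at this
    simpa using this
  · intro h
    have := queueSup_le_add η ζ x
    rw [h, top_le_iff, ENNReal.add_eq_top] at this
    simpa using this

theorem queueSup_eq_top_iff (η : ℤ → ℕ) (ζ : ℤ → Label) (x : ℤ) :
    queueSup η ζ x = ⊤ ↔ queueSup η ζ 0 = ⊤ := by
  induction x using Int.induction_on with
  | zero => rfl
  | succ i ih => rw [← ih, ← queueSup_sub_one_eq_top_iff η ζ (i + 1), add_sub_cancel_right]
  | pred i ih => rw [← ih, queueSup_sub_one_eq_top_iff]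

theorem bddAbove_queue_iff (η : ℤ → ℕ) (ζ : ℤ → Label) (x : ℤ) :
    BddAbove (Set.range fun N => queue η ζ N x) ↔ queueSup η ζ x ≠ ⊤ := by
  constructor
  · rintro ⟨B, hB⟩
    refine ne_top_of_le_ne_top (ENNReal.natCast_ne_top B) (iSup_le fun N => ?_)
    exact_mod_cast hB ⟨N, rfl⟩
  · intro h
    obtain ⟨B, hB⟩ := ENNReal.exists_nat_gt h
    refine ⟨B, ?_⟩
    rintro _ ⟨N, rfl⟩
    have := (le_iSup (fun N => (queue η ζ N x : ℝ≥0∞)) N).trans hB.le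
    exact_mod_cast this

theorem stabilizable_iff_queueSup {η : ℤ → ℕ} {ζ : ℤ → Label} (hl : ∀ x, ζ x ≠ Label.l)
    (hζ : IsSparse ζ) : Stabilizable η ζ ↔ queueSup η ζ 0 ≠ ⊤ := by
  rw [stabilizable_iff_bddAbove_queue hl hζ]
  simp only [bddAbove_queue_iff, ne_eq, queueSup_eq_top_iff, forall_const]

/-- The translation of height configurations on `ℤ`. -/
def shiftHeight (η : ℤ → ℕ) : ℤ → ℕ := fun x => η (x + 1)

theorem service_shift (η : ℤ → ℕ) (ζ : ℤ → Label) (x : ℤ) :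
    service (shiftHeight η) (shift ζ) x = service η ζ (x + 1) := by
  have h : shiftHeight η (x - 1) = η (x + 1 - 1) := by rw [shiftHeight]; congr 1; ring
  rw [service, service, h]
  rfl

theorem queue_shift (η : ℤ → ℕ) (ζ : ℤ → Label) (N : ℕ) :
    ∀ x, queue (shiftHeight η) (shift ζ) N x = queue η ζ N (x + 1) := by
  induction N with
  | zero => intro x; rfl
  | succ N ih =>
    intro x
    rw [queue, queue, ih, service_shift, shiftHeight, show x - 1 + 1 = x + 1 - 1 by ring]

theorem queueSup_shift (η : ℤ → ℕ) (ζ : ℤ → Label) (x : ℤ) :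
    queueSup (shiftHeight η) (shift ζ) x = queueSup η ζ (x + 1) := by
  simp only [queueSup, queue_shift]

section Measurability

variable {α : Type*} {m : MeasurableSpace α} {H : α → ℤ → ℕ} {Z : α → ℤ → Label}

/-- Heights are required only up to `x + 1`, with an arbitrary σ-algebra, so that the tail σ-algebra
at minus infinity can be used later. -/
theorem measurable_service {x : ℤ} (hH : ∀ y ≤ x + 1, Measurable fun ω => H ω y)
    (hZ : Measurable fun ω => Z ω x) : Measurable fun ω => service (H ω) (Z ω) x := by
  have h1 : Measurable fun q : Label × ℕ × ℕ =>
      if q.1 = Label.s ∧ Even q.2.1 ∧ Even q.2.2 then 1 else 0 := Measurable.of_discrete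
  exact h1.comp (hZ.prodMk ((hH (x - 1) (by omega)).prodMk (hH (x + 1) le_rfl)))

theorem measurable_queue (N : ℕ) : ∀ {x : ℤ}, (∀ y ≤ x + 1, Measurable fun ω => H ω y) →
    (∀ y, Measurable fun ω => Z ω y) → Measurable fun ω => queue (H ω) (Z ω) N x := by
  induction N with
  | zero => intro x _ _; exact measurable_const
  | succ N ih =>
    intro x hH hZ
    have h1 : Measurable fun q : ℕ × ℕ × ℕ => q.1 + q.2.1 / 2 - q.2.2 := Measurable.of_discrete
    exact h1.comp ((ih (x := x - 1) (fun y hy => hH y (by omega)) hZ).prodMk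
      ((hH x (by omega)).prodMk (measurable_service hH (hZ x))))

theorem measurable_queueSup {x : ℤ} (hH : ∀ y ≤ x + 1, Measurable fun ω => H ω y)
    (hZ : ∀ y, Measurable fun ω => Z ω y) : Measurable fun ω => queueSup (H ω) (Z ω) x :=
  Measurable.iSup fun N => Measurable.of_discrete.comp (measurable_queue N hH hZ)

end Measurability

theorem measurable_height (y : ℤ) : Measurable fun p : (ℤ → ℕ) × (ℤ → Label) => p.1 y :=
  (measurable_pi_apply y).comp measurable_fst

theorem measurable_label (y : ℤ) : Measurable fun p : (ℤ → ℕ) × (ℤ → Label) => p.2 y :=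
  (measurable_pi_apply y).comp measurable_snd

theorem measurable_natCast_comp {α : Type*} [MeasurableSpace α] {f : α → ℕ} (hf : Measurable f) :
    Measurable fun ω => (f ω : ℝ≥0∞) :=
  (Measurable.of_discrete (f := fun n : ℕ => (n : ℝ≥0∞))).comp hf

/-- The joint translation of heights and environments. -/
def shiftState (p : (ℤ → ℕ) × (ℤ → Label)) : (ℤ → ℕ) × (ℤ → Label) :=
  (shiftHeight p.1, shift p.2)

section Stationary

variable {P : Measure ((ℤ → ℕ) × (ℤ → Label))} [IsProbabilityMeasure P]

/-- If the stationary queue is almost surely finite, the arrival rate is at most the service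
rate. -/
theorem lintegral_arrival_le_lintegral_service (hP : MeasurePreserving shiftState P P)
    (h : ∀ᵐ p ∂P, queueSup p.1 p.2 0 ≠ ⊤) :
    ∫⁻ p, ((p.1 0 / 2 : ℕ) : ℝ≥0∞) ∂P ≤ ∫⁻ p, (service p.1 p.2 0 : ℝ≥0∞) ∂P := by
  set X : (ℤ → ℕ) × (ℤ → Label) → ℝ≥0∞ := fun p => queueSup p.1 p.2 (-1) with hX
  set Y : (ℤ → ℕ) × (ℤ → Label) → ℝ≥0∞ := fun p => queueSup p.1 p.2 0 with hY
  set A : (ℤ → ℕ) × (ℤ → Label) → ℝ≥0∞ := fun p => ((p.1 0 / 2 : ℕ) : ℝ≥0∞) with hA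
  set R : (ℤ → ℕ) × (ℤ → Label) → ℝ≥0∞ := fun p => (service p.1 p.2 0 : ℝ≥0∞) with hR
  have mX : Measurable X := measurable_queueSup (fun y _ => measurable_height y) measurable_label
  have mY : Measurable Y := measurable_queueSup (fun y _ => measurable_height y) measurable_label
  have mA : Measurable A := measurable_natCast_comp
    (f := fun p : (ℤ → ℕ) × (ℤ → Label) => p.1 0 / 2)
    ((Measurable.of_discrete (f := fun n : ℕ => n / 2)).comp (measurable_height 0))
  have mR : Measurable R := measurable_natCast_comp
    (measurable_service (fun y _ => measurable_height y) (measurable_label 0))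
  have hXY : ∀ p, X p + A p ≤ Y p + R p := fun p => queueSup_add_le p.1 p.2 0
  -- The queue need not be integrable, so its equally distributed values at -1 and 0 are truncated
  -- at `K` before they are cancelled.
  have key : ∀ K : ℕ, ∫⁻ p, min (A p) (K - X p) ∂P ≤ ∫⁻ p, R p ∂P := by
    intro K
    have h1 : ∫⁻ p, min (Y p) K ∂P = ∫⁻ p, min (X p) K ∂P := by
      have : ∀ p, min (Y p) K = (fun p => min (X p) (K : ℝ≥0∞)) (shiftState p) := by
        intro p
        simp only [hX, hY, shiftState, queueSup_shift]
        norm_num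
      simp only [this]
      exact hP.lintegral_comp (mX.min measurable_const)
    have h2 : ∀ p, min (X p) K + min (A p) (K - X p) ≤ min (Y p) K + R p := by
      intro p
      have h3 : min (X p) K + min (A p) (K - X p) ≤ min (Y p + R p) K := by
        refine le_min ?_ ?_
        · exact (add_le_add (min_le_left _ _) (min_le_left _ _)).trans (hXY p)
        · rcases le_total (X p) K with hle | hle
          · calc min (X p) K + min (A p) (K - X p) ≤ X p + (K - X p) :=
                add_le_add (min_le_left _ _) (min_le_right _ _)
              _ = K := add_tsub_cancel_of_le hle
          · rw [tsub_eq_zero_of_le hle]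
            simp
      refine h3.trans ?_
      rw [min_add]
      exact min_le_min le_rfl le_self_add
    have h3 : ∫⁻ p, min (X p) K ∂P ≠ ⊤ := by
      refine ne_top_of_le_ne_top (ENNReal.natCast_ne_top K) ?_
      calc ∫⁻ p, min (X p) K ∂P ≤ ∫⁻ _, (K : ℝ≥0∞) ∂P := lintegral_mono fun p => min_le_right _ _
        _ = K := by simp
    have h4 : ∫⁻ p, min (X p) K ∂P + ∫⁻ p, min (A p) (K - X p) ∂P ≤
        ∫⁻ p, min (X p) K ∂P + ∫⁻ p, R p ∂P := by
      rw [← lintegral_add_left (mX.min measurable_const), ← h1,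
        ← lintegral_add_left (mY.min measurable_const)]
      exact lintegral_mono h2
    exact (ENNReal.add_le_add_iff_left h3).1 h4
  calc ∫⁻ p, A p ∂P ≤ ∫⁻ p, ⨆ K : ℕ, min (A p) (K - X p) ∂P := by
        refine lintegral_mono_ae ?_
        filter_upwards [h] with p hp
        have hXp : X p ≠ ⊤ := by
          rw [hX]
          simpa only [ne_eq, queueSup_eq_top_iff p.1 p.2 (-1)] using hp
        obtain ⟨K, hK⟩ := ENNReal.exists_nat_gt
          (ENNReal.add_ne_top.2 ⟨ENNReal.natCast_ne_top (p.1 0 / 2), hXp⟩)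
        refine le_iSup_of_le K (le_min le_rfl ?_)
        exact ENNReal.le_sub_of_add_le_right hXp hK.le
    _ = ⨆ K : ℕ, ∫⁻ p, min (A p) (K - X p) ∂P := by
        refine lintegral_iSup (fun K => mA.min (measurable_const.sub mX)) ?_
        intro K L hKL p
        dsimp only
        gcongr
    _ ≤ _ := iSup_le key

/-- If the stationary queue is almost surely infinite, the service rate is at most the arrival
rate. -/
theorem lintegral_service_le_lintegral_arrival (hP : MeasurePreserving shiftState P P)
    (h : ∀ᵐ p ∂P, queueSup p.1 p.2 0 = ⊤) :
    ∫⁻ p, (service p.1 p.2 0 : ℝ≥0∞) ∂P ≤ ∫⁻ p, ((p.1 0 / 2 : ℕ) : ℝ≥0∞) ∂P := by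
  by_cases hfin : ∫⁻ p, ((p.1 0 / 2 : ℕ) : ℝ≥0∞) ∂P = ⊤
  · rw [hfin]; exact le_top
  have mq : ∀ N x, Measurable fun p : (ℤ → ℕ) × (ℤ → Label) => (queue p.1 p.2 N x : ℝ≥0∞) :=
    fun N x => measurable_natCast_comp
      (measurable_queue N (fun y _ => measurable_height y) measurable_label)
  have mR : Measurable fun p : (ℤ → ℕ) × (ℤ → Label) => (service p.1 p.2 0 : ℝ≥0∞) :=
    measurable_natCast_comp (measurable_service (fun y _ => measurable_height y)
      (measurable_label 0))
  have hstat : ∀ N, ∫⁻ p, (queue p.1 p.2 N 0 : ℝ≥0∞) ∂P =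
      ∫⁻ p, (queue p.1 p.2 N (-1) : ℝ≥0∞) ∂P := by
    intro N
    have : ∀ p : (ℤ → ℕ) × (ℤ → Label), (queue p.1 p.2 N 0 : ℝ≥0∞) =
        (fun p : (ℤ → ℕ) × (ℤ → Label) => (queue p.1 p.2 N (-1) : ℝ≥0∞)) (shiftState p) := by
      intro p
      simp only [shiftState, queue_shift]
      norm_num
    simp only [this]
    exact hP.lintegral_comp (mq N (-1))
  have hq : ∀ N, ∫⁻ p, (queue p.1 p.2 N 0 : ℝ≥0∞) ∂P ≠ ⊤ := by
    intro N
    induction N with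
    | zero => simp [queue]
    | succ N ih =>
      refine ne_top_of_le_ne_top (ENNReal.add_ne_top.2 ⟨hstat N ▸ ih, hfin⟩) ?_
      rw [← lintegral_add_left (mq N (-1))]
      refine lintegral_mono fun p => ?_
      rw [queue, zero_sub]
      exact (Nat.mono_cast (Nat.sub_le _ _)).trans_eq (Nat.cast_add _ _)
  -- Monotonicity in `N` gives a one-step balance in which only `min` of service and queue is really
  -- used; the integrable queues at -1 and 0 cancel. As the queue diverges, the minimum tends to the
  -- full service.
  have key : ∀ N, ∫⁻ p, min (service p.1 p.2 0 : ℝ≥0∞) (queue p.1 p.2 N (-1)) ∂P ≤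
      ∫⁻ p, ((p.1 0 / 2 : ℕ) : ℝ≥0∞) ∂P := by
    intro N
    have h1 : ∀ p : (ℤ → ℕ) × (ℤ → Label), (queue p.1 p.2 N 0 : ℝ≥0∞) +
        min (service p.1 p.2 0 : ℝ≥0∞) (queue p.1 p.2 N (-1)) ≤
        queue p.1 p.2 N (-1) + ((p.1 0 / 2 : ℕ) : ℝ≥0∞) := by
      intro p
      have h2 := queue_le_queue_succ p.1 p.2 N 0
      rw [queue, zero_sub] at h2
      have h3 : queue p.1 p.2 N 0 + min (service p.1 p.2 0) (queue p.1 p.2 N (-1)) ≤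
          queue p.1 p.2 N (-1) + p.1 0 / 2 := by omega
      rw [← (Nat.mono_cast (α := ℝ≥0∞)).map_min]
      exact_mod_cast h3
    have h3 := lintegral_mono (μ := P) h1
    rw [lintegral_add_left (mq N 0), lintegral_add_left (mq N (-1)), ← hstat] at h3
    exact (ENNReal.add_le_add_iff_left (hq N)).1 h3
  calc ∫⁻ p, (service p.1 p.2 0 : ℝ≥0∞) ∂P
      ≤ ∫⁻ p, ⨆ N, min (service p.1 p.2 0 : ℝ≥0∞) (queue p.1 p.2 N (-1)) ∂P := by
        refine lintegral_mono_ae ?_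
        filter_upwards [h] with p hp
        have hp' : queueSup p.1 p.2 (-1) = ⊤ := (queueSup_eq_top_iff _ _ _).2 hp
        obtain ⟨N, hN⟩ : ∃ N, (1 : ℝ≥0∞) < queue p.1 p.2 N (-1) :=
          lt_iSup_iff.1 (lt_of_lt_of_eq ENNReal.one_lt_top hp'.symm)
        refine le_iSup_of_le N (le_min le_rfl (le_trans ?_ hN.le))
        exact_mod_cast service_le_one p.1 p.2 0
    _ = ⨆ N, ∫⁻ p, min (service p.1 p.2 0 : ℝ≥0∞) (queue p.1 p.2 N (-1)) ∂P := by
        refine lintegral_iSup (fun N => mR.min (mq N (-1))) ?_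
        intro N M hNM p
        dsimp only
        have := queue_monotone p.1 p.2 (-1) hNM
        gcongr
    _ ≤ _ := iSup_le key

end Stationary

/-! ### The zero-one law -/

/-- Heights are finite, so divergence at one site is divergence at every site to its left. The event
is therefore a tail event at minus infinity of independent heights. -/
theorem measure_queueSup_zero_or_one (κ : Measure ℕ) [IsProbabilityMeasure κ] (ζ : ℤ → Label) :
    Measure.infinitePi (fun _ : ℤ => κ) {η | queueSup η ζ 0 = ⊤} = 0 ∨
      Measure.infinitePi (fun _ : ℤ => κ) {η | queueSup η ζ 0 = ⊤} = 1 := by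
  let s : ℤ → MeasurableSpace (ℤ → ℕ) := fun x => MeasurableSpace.comap (fun η => η x) ⊤
  have hind : iIndep s (Measure.infinitePi fun _ : ℤ => κ) :=
    iIndepFun_infinitePi (X := fun _ η => η) (by fun_prop)
  refine measure_zero_or_one_of_measurableSet_limsup_atBot (s := s)
    (fun x => (measurable_pi_apply x).comap_le) hind ?_
  rw [Filter.atBot_basis.limsup_eq_iInf_iSup]
  simp only [MeasurableSpace.measurableSet_iInf]
  intro i _
  have hset : {η | queueSup η ζ 0 = ⊤} = {η | queueSup η ζ (i - 1) = ⊤} := by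
    ext η
    exact (queueSup_eq_top_iff η ζ (i - 1)).symm
  rw [hset]
  have hm : Measurable[⨆ a ∈ Set.Iic i, s a] fun η => queueSup η ζ (i - 1) := by
    refine @measurable_queueSup _ (⨆ a ∈ Set.Iic i, s a) (fun η => η) (fun _ => ζ) (i - 1) ?_ ?_
    · intro y hy
      have hle : s y ≤ ⨆ a ∈ Set.Iic i, s a :=
        le_iSup₂_of_le y (by simp only [Set.mem_Iic]; omega) le_rfl
      exact (comap_measurable fun η : ℤ → ℕ => η y).mono hle le_rfl
    · exact fun y => measurable_const
  exact hm (measurableSet_singleton ⊤)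

theorem measurePreserving_shiftHeight (κ : Measure ℕ) [IsProbabilityMeasure κ] :
    MeasurePreserving shiftHeight (Measure.infinitePi fun _ : ℤ => κ)
      (Measure.infinitePi fun _ : ℤ => κ) where
  measurable := measurable_pi_lambda _ fun x => measurable_pi_apply (x + 1)
  map_eq := Measure.map_infinitePi_infinitePi_of_inj (P := fun _ : ℤ => κ) (f := fun x : ℤ => x + 1)
    (add_left_injective 1)

theorem measurePreserving_shiftState (κ : Measure ℕ) [IsProbabilityMeasure κ]
    {ν : Measure (ℤ → Label)} [IsProbabilityMeasure ν] (hν : MeasurePreserving shift ν ν) :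
    MeasurePreserving shiftState ((Measure.infinitePi fun _ : ℤ => κ).prod ν)
      ((Measure.infinitePi fun _ : ℤ => κ).prod ν) :=
  (measurePreserving_shiftHeight κ).prod hν

theorem ae_queueSup_eq_top_or (κ : Measure ℕ) [IsProbabilityMeasure κ]
    {ν : Measure (ℤ → Label)} [IsProbabilityMeasure ν] (hν : Ergodic shift ν) :
    (∀ᵐ p ∂((Measure.infinitePi fun _ : ℤ => κ).prod ν), queueSup p.1 p.2 0 = ⊤) ∨
      ∀ᵐ p ∂((Measure.infinitePi fun _ : ℤ => κ).prod ν), queueSup p.1 p.2 0 ≠ ⊤ := by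
  set μ := Measure.infinitePi fun _ : ℤ => κ with hμ
  have mE : MeasurableSet {p : (ℤ → ℕ) × (ℤ → Label) | queueSup p.1 p.2 0 = ⊤} :=
    (measurable_queueSup (fun y _ => measurable_height y) measurable_label)
      (measurableSet_singleton ⊤)
  have mg : Measurable fun ζ => μ {η | queueSup η ζ 0 = ⊤} := measurable_measure_prodMk_right mE
  -- The set of environments with divergence probability one is shift-invariant, because the law of
  -- the heights is; ergodicity of `ν` alone then decides, without ergodicity of the product.
  have hinv : shift ⁻¹' {ζ | μ {η | queueSup η ζ 0 = ⊤} = 1} =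
      {ζ | μ {η | queueSup η ζ 0 = ⊤} = 1} := by
    ext ζ
    have h1 : μ {η | queueSup η (shift ζ) 0 = ⊤} = μ {η | queueSup η ζ 0 = ⊤} := by
      rw [← (measurePreserving_shiftHeight κ).measure_preimage]
      · congr 1
        ext η
        simp only [Set.preimage_ofPred_eq, Set.mem_ofPred_eq, queueSup_shift, queueSup_eq_top_iff]
      · have : Measurable fun η => queueSup η (shift ζ) 0 :=
          measurable_queueSup (H := fun η => η) (fun y _ => measurable_pi_apply y)
            fun y => measurable_const
        exact (this (measurableSet_singleton ⊤)).nullMeasurableSet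
    simp only [Set.preimage_ofPred_eq, Set.mem_ofPred_eq, h1]
  have hP := Measure.prod_apply_symm (μ := μ) (ν := ν) mE
  rcases hν.toPreErgodic.ae_mem_or_ae_notMem (mg (measurableSet_singleton 1)) hinv with h | h
  · left
    rw [ae_iff, ← Set.compl_ofPred, prob_compl_eq_zero_iff mE, hP,
      lintegral_congr_ae (g := fun _ => 1)]
    · simp
    · exact h
  · right
    rw [ae_iff]
    simp only [ne_eq, not_not]
    rw [hP, lintegral_congr_ae (g := fun _ => 0)]
    · simp
    · filter_upwards [h] with ζ hζ
      exact (measure_queueSup_zero_or_one κ ζ).resolve_right hζ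

open scoped NNReal Nat

/-! ### Poisson expectations -/

theorem lintegral_poissonMeasure {r : ℝ≥0} {f : ℕ → ℝ} (hf : ∀ n, 0 ≤ f n) {a : ℝ}
    (h : HasSum (fun n : ℕ => Real.exp (-r) * r ^ n / n ! * f n) a) :
    ∫⁻ n, ENNReal.ofReal (f n) ∂(poissonMeasure r) = ENNReal.ofReal a := by
  rw [poissonMeasure, lintegral_sum_measure]
  simp only [lintegral_smul_measure, lintegral_dirac, smul_eq_mul]
  rw [← h.tsum_eq, ENNReal.ofReal_tsum_of_nonneg
    (fun n => mul_nonneg (by positivity) (hf n)) h.summable]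
  refine tsum_congr fun n => ?_
  rw [ENNReal.ofReal_mul (by positivity)]

theorem hasSum_poisson_alternating (r : ℝ≥0) :
    HasSum (fun n : ℕ => Real.exp (-r) * r ^ n / n ! * (-1) ^ n) (Real.exp (-2 * r)) := by
  have h := (NormedSpace.expSeries_div_hasSum_exp (-r : ℝ)).mul_left (Real.exp (-r))
  rw [← Real.exp_eq_exp_ℝ, ← Real.exp_add] at h
  convert! h using 1
  · funext n
    rw [neg_pow (r : ℝ) n]
    ring
  · congr 1
    ring

theorem hasSum_poisson_mean (r : ℝ≥0) :
    HasSum (fun n : ℕ => Real.exp (-r) * r ^ n / n ! * n) r := by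
  rw [← hasSum_nat_add_iff' 1]
  have h := (hasSum_one_poissonMeasure r).mul_left (r : ℝ)
  convert! h using 1
  · funext n
    rw [Nat.factorial_succ]
    push_cast
    field_simp
    ring
  · simp

theorem natCast_div_two (n : ℕ) : ((n / 2 : ℕ) : ℝ) = ((n : ℝ) - (1 - (-1) ^ n) / 2) / 2 := by
  rcases Nat.even_or_odd' n with ⟨k, rfl | rfl⟩
  · have : 2 * k / 2 = k := by omega
    rw [this, pow_mul]
    push_cast
    norm_num
  · have : (2 * k + 1) / 2 = k := by omega
    rw [this, pow_succ, pow_mul]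
    push_cast
    norm_num

theorem lintegral_poissonMeasure_half (r : ℝ≥0) :
    ∫⁻ n, ((n / 2 : ℕ) : ℝ≥0∞) ∂(poissonMeasure r) =
      ENNReal.ofReal ((r - (1 - Real.exp (-2 * r)) / 2) / 2) := by
  have h : HasSum (fun n : ℕ => Real.exp (-r) * r ^ n / n ! * ((n / 2 : ℕ) : ℝ))
      ((r - (1 - Real.exp (-2 * r)) / 2) / 2) := by
    convert! ((hasSum_poisson_mean r).sub (((hasSum_one_poissonMeasure r).sub
      (hasSum_poisson_alternating r)).div_const 2)).div_const 2 using 1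
    funext n
    rw [natCast_div_two]
    ring
  rw [← lintegral_poissonMeasure (fun n => Nat.cast_nonneg _) h]
  simp

theorem poissonMeasure_even (r : ℝ≥0) :
    poissonMeasure r {n | Even n} = ENNReal.ofReal ((1 + Real.exp (-2 * r)) / 2) := by
  have h1 : ∀ n : ℕ, (1 + (-1 : ℝ) ^ n) / 2 = if Even n then 1 else 0 := by
    intro n
    split_ifs with hn
    · rw [hn.neg_one_pow]; norm_num
    · rw [(Nat.not_even_iff_odd.1 hn).neg_one_pow]; norm_num
  have h : HasSum (fun n : ℕ => Real.exp (-r) * r ^ n / n ! * if Even n then 1 else 0)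
      ((1 + Real.exp (-2 * r)) / 2) := by
    convert! ((hasSum_one_poissonMeasure r).add (hasSum_poisson_alternating r)).div_const 2 using 1
    funext n
    rw [← h1]
    ring
  rw [← lintegral_poissonMeasure (fun n => by split_ifs <;> norm_num) h,
    ← lintegral_indicator_one MeasurableSet.of_discrete]
  refine lintegral_congr fun n => ?_
  by_cases hn : Even n <;> simp [hn]

/-! ### Arrival and service rates -/

instance (r : ℝ≥0) : IsProbabilityMeasure (poissonField r) := by
  rw [poissonField]; infer_instance

theorem lintegral_arrival (r : ℝ≥0) (ν : Measure (ℤ → Label)) [IsProbabilityMeasure ν] :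
    ∫⁻ p, ((p.1 0 / 2 : ℕ) : ℝ≥0∞) ∂((poissonField r).prod ν) =
      ENNReal.ofReal ((r - (1 - Real.exp (-2 * r)) / 2) / 2) := by
  rw [← lintegral_poissonMeasure_half]
  have h1 : MeasurePreserving (fun η : ℤ → ℕ => η 0) (poissonField r) (poissonMeasure r) :=
    measurePreserving_eval_infinitePi (fun _ : ℤ => poissonMeasure r) 0
  have h2 : MeasurePreserving Prod.fst ((poissonField r).prod ν) (poissonField r) :=
    measurePreserving_fst
  exact (h1.comp h2).lintegral_comp (f := fun n : ℕ => ((n / 2 : ℕ) : ℝ≥0∞)) Measurable.of_discrete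

theorem lintegral_service (r : ℝ≥0) (ν : Measure (ℤ → Label)) [IsProbabilityMeasure ν] :
    ∫⁻ p, (service p.1 p.2 0 : ℝ≥0∞) ∂((poissonField r).prod ν) =
      ENNReal.ofReal (ν.real {ζ | ζ 0 = Label.s} * ((1 + Real.exp (-2 * r)) / 2) ^ 2) := by
  have hset : MeasurableSet (Set.pi (({-1, 1} : Finset ℤ) : Set ℤ) fun _ => {n : ℕ | Even n}) :=
    MeasurableSet.pi (Finset.countable_toSet _) fun _ _ => MeasurableSet.of_discrete
  have h1 : ∀ p : (ℤ → ℕ) × (ℤ → Label), (service p.1 p.2 0 : ℝ≥0∞) =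
      ((Set.pi (({-1, 1} : Finset ℤ) : Set ℤ) fun _ => {n : ℕ | Even n}) ×ˢ
        {ζ : ℤ → Label | ζ 0 = Label.s}).indicator 1 p := by
    intro p
    classical
    simp only [service, Set.indicator_apply, Set.mem_prod, Set.mem_pi]
    simp only [zero_sub, zero_add, Finset.coe_insert, Finset.coe_singleton, Set.mem_insert_iff,
      Set.mem_singleton_iff, forall_eq_or_imp, forall_eq, Set.mem_ofPred_eq, Pi.one_apply,
      and_comm (a := p.2 0 = Label.s)]
    split_ifs <;> simp
  simp only [h1]
  rw [lintegral_indicator_one (hset.prod (measurableSet_label 0 Label.s)), Measure.prod_prod,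
    poissonField, Measure.infinitePi_pi _ fun _ _ => MeasurableSet.of_discrete]
  rw [Finset.prod_const, show ({-1, 1} : Finset ℤ).card = 2 by decide, poissonMeasure_even,
    ENNReal.ofReal_mul (by positivity), ENNReal.ofReal_pow (by positivity), mul_comm,
    ofReal_measureReal]

/-! ### The transition density -/

/-- The difference of the two sides of the equation for the transition density, when the label `s`
has density `f`. -/
noncomputable def transitionGap (f ρ : ℝ) : ℝ :=
  ρ - 1 / 2 * (1 - Real.exp (-2 * ρ)) - f / 2 * (1 + Real.exp (-2 * ρ)) ^ 2

theorem transitionGap_lt {f : ℝ} (hf : 0 ≤ f) {x y : ℝ} (hx : 0 ≤ x) (hxy : x < y) :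
    transitionGap f x < transitionGap f y := by
  have h1 : Real.exp (-2 * y) ≤ Real.exp (-2 * x) := Real.exp_le_exp.2 (by linarith)
  have h2 : Real.exp (-2 * x) ≤ 1 := Real.exp_le_one_iff.2 (by linarith)
  have h3 : Real.exp (-2 * y) = Real.exp (-2 * x) * Real.exp (-2 * (y - x)) := by
    rw [← Real.exp_add]; congr 1; ring
  have h4 : -2 * (y - x) + 1 < Real.exp (-2 * (y - x)) := Real.add_one_lt_exp (by linarith)
  have h5 : Real.exp (-2 * (y - x)) ≤ 1 := Real.exp_le_one_iff.2 (by linarith)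
  have h6 : 0 < Real.exp (-2 * y) := Real.exp_pos _
  have h7 : f / 2 * (1 + Real.exp (-2 * y)) ^ 2 ≤ f / 2 * (1 + Real.exp (-2 * x)) ^ 2 := by
    gcongr
  -- Combined with `h4`, this bounds the drop of the exponential strictly by `2 * (y - x)`, so the
  -- linear term wins.
  have h8 : Real.exp (-2 * x) - Real.exp (-2 * y) ≤ 1 - Real.exp (-2 * (y - x)) := by
    rw [h3]
    nlinarith
  simp only [transitionGap]
  linarith

theorem exists_transitionGap_eq_zero {f : ℝ} (hf0 : 0 ≤ f) (hf1 : f ≤ 1) :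
    ∃ ρ, 0 ≤ ρ ∧ transitionGap f ρ = 0 := by
  have hc : Continuous (transitionGap f) := by unfold transitionGap; fun_prop
  have h0 : transitionGap f 0 ≤ 0 := by
    simp [transitionGap]
    linarith
  have h3 : 0 ≤ transitionGap f 3 := by
    have h1 : Real.exp (-2 * 3) ≤ 1 := Real.exp_le_one_iff.2 (by norm_num)
    have h2 : 0 < Real.exp (-2 * 3) := Real.exp_pos _
    have h4 : f / 2 * (1 + Real.exp (-2 * 3)) ^ 2 ≤ 1 / 2 * (1 + 1) ^ 2 := by gcongr
    rw [transitionGap]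
    generalize Real.exp (-2 * 3) = e at *
    linarith
  obtain ⟨ρ, hρ, h⟩ := intermediate_value_Icc (by norm_num : (0 : ℝ) ≤ 3) hc.continuousOn ⟨h0, h3⟩
  exact ⟨ρ, hρ.1, h⟩

theorem stabilizable_zero (ζ : ℤ → Label) : Stabilizable 0 ζ :=
  stabilizable_iff_exists_isSuperOdometer.2 ⟨0, fun x => by simp⟩

theorem zero_mem_stabilizingParameters (ν : Measure (ℤ → Label)) [IsProbabilityMeasure ν] :
    (0 : ℝ) ∈ stabilizingParameters ν := by
  refine ⟨le_rfl, ?_⟩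
  have h1 : ∀ x : ℤ, ∀ᵐ η ∂(poissonField (0 : ℝ).toNNReal), η x = 0 := by
    intro x
    have h2 : MeasurePreserving (fun η : ℤ → ℕ => η x) (poissonField (0 : ℝ).toNNReal)
        (poissonMeasure (0 : ℝ).toNNReal) :=
      measurePreserving_eval_infinitePi (fun _ : ℤ => poissonMeasure (0 : ℝ).toNNReal) x
    refine h2.quasiMeasurePreserving.ae (p := fun n => n = 0) ?_
    have h3 : poissonMeasure (0 : ℝ).toNNReal {0} = 1 := by
      rw [poissonMeasure_singleton]
      simp
    rw [ae_iff]
    exact (prob_compl_eq_zero_iff (measurableSet_singleton 0)).2 h3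
  have h2 := Measure.quasiMeasurePreserving_fst (μ := poissonField (0 : ℝ).toNNReal) (ν := ν)
    |>.ae (ae_all_iff.2 h1)
  filter_upwards [h2] with p hp
  have : p.1 = 0 := funext hp
  rw [this]
  exact stabilizable_zero _

theorem isTransitionDensity_of_ne_left {ν : Measure (ℤ → Label)} [IsProbabilityMeasure ν]
    (hν : Ergodic shift ν) (hl : ∀ᵐ ζ ∂ν, ∀ x, ζ x ≠ Label.l) (hs : ∀ᵐ ζ ∂ν, IsSparse ζ) {ρ : ℝ}
    (hρ0 : 0 ≤ ρ) (hρ : transitionGap (ν.real {ζ | ζ 0 = Label.s}) ρ = 0) :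
    IsTransitionDensity ν ρ := by
  set f := ν.real {ζ | ζ 0 = Label.s} with hf
  have hf0 : 0 ≤ f := measureReal_nonneg
  have hgood : ∀ r : ℝ≥0, ∀ᵐ p ∂((poissonField r).prod ν),
      (∀ x, p.2 x ≠ Label.l) ∧ IsSparse p.2 := fun r =>
    Measure.quasiMeasurePreserving_snd.ae (hl.and hs)
  have hpres : ∀ r : ℝ≥0, MeasurePreserving shiftState ((poissonField r).prod ν)
      ((poissonField r).prod ν) := fun r => measurePreserving_shiftState _ hν.toMeasurePreserving
  -- Arrival rate minus service rate is half the gap.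
  have hgap : ∀ σ, (σ - (1 - Real.exp (-2 * σ)) / 2) / 2 - f * ((1 + Real.exp (-2 * σ)) / 2) ^ 2 =
      transitionGap f σ / 2 := by
    intro σ
    rw [transitionGap]
    ring
  constructor
  · rintro σ ⟨hσ, h⟩
    by_contra hlt
    have hpos := transitionGap_lt hf0 hρ0 (not_le.1 hlt)
    rw [hρ] at hpos
    have h1 : ∀ᵐ p ∂((poissonField σ.toNNReal).prod ν), queueSup p.1 p.2 0 ≠ ⊤ := by
      filter_upwards [h, hgood σ.toNNReal] with p hp hg
      exact (stabilizable_iff_queueSup hg.1 hg.2).1 hp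
    have h2 := lintegral_arrival_le_lintegral_service (hpres _) h1
    rw [lintegral_arrival, lintegral_service, ENNReal.ofReal_le_ofReal_iff (by positivity),
      Real.coe_toNNReal σ hσ] at h2
    have := hgap σ
    linarith
  · intro B hB
    refine le_of_forall_lt_imp_le_of_dense fun σ hσ => ?_
    -- When no label is `s`, `ρ` is 0 and no nonnegative `σ` lies below it; membership of 0 then
    -- carries the bound.
    rcases lt_or_ge σ 0 with hneg | hσ0
    · exact hneg.le.trans (hB (zero_mem_stabilizingParameters ν))
    refine hB ⟨hσ0, ?_⟩
    have hlt := transitionGap_lt hf0 hσ0 hσ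
    rw [hρ] at hlt
    rcases ae_queueSup_eq_top_or (poissonMeasure σ.toNNReal) hν with h | h
    · exfalso
      have h2 := lintegral_service_le_lintegral_arrival (hpres σ.toNNReal) h
      have hnn : 0 ≤ (σ - (1 - Real.exp (-2 * σ)) / 2) / 2 := by
        have := Real.add_one_le_exp (-2 * σ)
        linarith
      rw [lintegral_arrival, lintegral_service, Real.coe_toNNReal σ hσ0,
        ENNReal.ofReal_le_ofReal_iff hnn] at h2
      have := hgap σ
      linarith
    · have h' : ∀ᵐ p ∂((poissonField σ.toNNReal).prod ν), queueSup p.1 p.2 0 ≠ ⊤ := h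
      filter_upwards [h', hgood σ.toNNReal] with p hp hg
      exact (stabilizable_iff_queueSup hg.1 hg.2).2 hp

/-! ### Reflection of the environment -/

/-- The translation of environments as a measurable equivalence. -/
def shiftEquiv : (ℤ → Label) ≃ᵐ (ℤ → Label) where
  toFun := shift
  invFun ζ := fun x => ζ (x - 1)
  left_inv ζ := by funext x; simp [shift]
  right_inv ζ := by funext x; simp [shift]
  measurable_toFun := measurable_pi_lambda _ fun x => measurable_pi_apply (x + 1)
  measurable_invFun := measurable_pi_lambda _ fun x => measurable_pi_apply (x - 1)

theorem measurable_reflectEnv : Measurable reflectEnv :=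
  measurable_pi_lambda _ fun x =>
    (Measurable.of_discrete (f := Label.flip)).comp (measurable_pi_apply (-x))

theorem measurePreserving_reflectEnv_map (ν : Measure (ℤ → Label)) :
    MeasurePreserving reflectEnv (ν.map reflectEnv) ν := by
  refine ⟨measurable_reflectEnv, ?_⟩
  rw [Measure.map_map measurable_reflectEnv measurable_reflectEnv]
  have : reflectEnv ∘ reflectEnv = id := funext reflectEnv_reflectEnv
  rw [this, Measure.map_id]

/-- Reflection conjugates the shift to its inverse, which is ergodic as well. -/
theorem ergodic_shift_map_reflectEnv {ν : Measure (ℤ → Label)} (hν : Ergodic shift ν) :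
    Ergodic shift (ν.map reflectEnv) := by
  have h1 : Ergodic shiftEquiv.symm ν := Ergodic.symm (e := shiftEquiv) hν
  refine (measurable_reflectEnv.measurePreserving ν).ergodic_of_ergodic_semiconj h1
    hν.measurable ?_
  intro ζ
  funext x
  simp only [reflectEnv, shift]
  congr 1
  exact congrArg ζ (by ring)

theorem measurePreserving_reflectHeight (r : ℝ≥0) :
    MeasurePreserving (fun (η : ℤ → ℕ) x => η (-x)) (poissonField r) (poissonField r) where
  measurable := measurable_pi_lambda _ fun x => measurable_pi_apply (-x)
  map_eq := Measure.map_infinitePi_infinitePi_of_inj (P := fun _ : ℤ => poissonMeasure r)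
    neg_injective

theorem stabilizingParameters_subset {ν ν' : Measure (ℤ → Label)} [IsProbabilityMeasure ν]
    [IsProbabilityMeasure ν'] (h : MeasurePreserving reflectEnv ν ν') :
    stabilizingParameters ν' ⊆ stabilizingParameters ν := by
  rintro ρ ⟨hρ, hs⟩
  refine ⟨hρ, ?_⟩
  have := ((measurePreserving_reflectHeight ρ.toNNReal).prod h).quasiMeasurePreserving.ae hs
  filter_upwards [this] with p hp
  exact stabilizable_reflect_iff.1 hp

theorem IsSparse.of_reflectEnv {ζ : ℤ → Label} (h : IsSparse (reflectEnv ζ)) : IsSparse ζ := by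
  intro x
  simp only [IsSparse, reflectEnv, Label.flip_eq_s] at h
  have h1 := (h (-(x + 1))).1
  have h2 := (h (-(x + 2))).2
  rw [neg_neg, show -(-(x + 1) + 1) = x by ring] at h1
  rw [neg_neg, show -(-(x + 2) + 2) = x by ring] at h2
  exact ⟨fun h => h1 h.symm, fun h => h2 h.symm⟩

theorem isTransitionDensity_of_transitionGap {ν : Measure (ℤ → Label)} [IsProbabilityMeasure ν]
    (hν : Ergodic shift ν) (hdir : IsDirected ν) (hres : IsRestricted ν) {ρ : ℝ}
    (hρ0 : 0 ≤ ρ) (hρ : transitionGap (ν.real {ζ | ζ 0 = Label.s}) ρ = 0) :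
    IsTransitionDensity ν ρ := by
  rcases hdir with h | h
  · have hmap := measurable_reflectEnv.measurePreserving ν
    have hmap' := measurePreserving_reflectEnv_map ν
    have : IsProbabilityMeasure (ν.map reflectEnv) :=
      Measure.isProbabilityMeasure_map measurable_reflectEnv.aemeasurable
    have heq : stabilizingParameters ν = stabilizingParameters (ν.map reflectEnv) :=
      (stabilizingParameters_subset hmap').antisymm (stabilizingParameters_subset hmap)
    have hr := hmap'.quasiMeasurePreserving.ae (ae_ne_label hν.toMeasurePreserving h)
    have hs := hmap'.quasiMeasurePreserving.ae hres.ae_isSparse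
    rw [IsTransitionDensity, heq]
    refine isTransitionDensity_of_ne_left (ergodic_shift_map_reflectEnv hν) ?_ ?_ hρ0 ?_
    · filter_upwards [hr] with ζ hζ x hx
      refine hζ (-x) ?_
      simp [reflectEnv, hx, Label.flip]
    · filter_upwards [hs] with ζ hζ using hζ.of_reflectEnv
    · have h1 : (ν.map reflectEnv).real {ζ | ζ 0 = Label.s} = ν.real {ζ | ζ 0 = Label.s} := by
        rw [measureReal_def, Measure.map_apply measurable_reflectEnv (measurableSet_label 0 _),
          measureReal_def]
        congr 2
        ext ζ
        simp [reflectEnv]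
      rw [h1, hρ]
  · exact isTransitionDensity_of_ne_left hν (ae_ne_label hν.toMeasurePreserving h) hres.ae_isSparse
      hρ0 hρ

/-! ### Comparison of the two densities -/

theorem real_label_s {ν : Measure (ℤ → Label)} [IsProbabilityMeasure ν] :
    ν.real {ζ | ζ 0 = Label.s} = 1 - directedFraction ν := by
  have h := probReal_compl_eq_one_sub (μ := ν) (measurableSet_label 0 Label.s)
  have h1 : directedFraction ν = ν.real {ζ | ζ 0 = Label.s}ᶜ := rfl
  rw [h1, h]
  ring

/-- The events of an `s` at 0, 1 and 2 are almost surely disjoint and equally likely. -/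
theorem real_label_s_le {ν : Measure (ℤ → Label)} [IsProbabilityMeasure ν]
    (hν : MeasurePreserving shift ν ν) (hres : IsRestricted ν) :
    ν.real {ζ | ζ 0 = Label.s} ≤ 1 / 3 := by
  have h0 := hres 0
  have h1 := (hres 1).1
  simp only [zero_add] at h0
  have hreal : ∀ x, ν.real {ζ | ζ x = Label.s} = ν.real {ζ | ζ 0 = Label.s} := fun x => by
    rw [measureReal_def, measure_label_eq hν, measureReal_def]
  have hd1 : ν.real ({ζ | ζ 0 = Label.s} ∪ {ζ | ζ 1 = Label.s}) =
      ν.real {ζ | ζ 0 = Label.s} + ν.real {ζ | ζ 1 = Label.s} :=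
    measureReal_union₀ (measurableSet_label 1 _).nullMeasurableSet h0.1
  have hd2 : ν.real (({ζ | ζ 0 = Label.s} ∪ {ζ | ζ 1 = Label.s}) ∪ {ζ | ζ 2 = Label.s}) =
      ν.real ({ζ | ζ 0 = Label.s} ∪ {ζ | ζ 1 = Label.s}) + ν.real {ζ | ζ 2 = Label.s} := by
    refine measureReal_union₀ (measurableSet_label 2 _).nullMeasurableSet ?_
    rw [AEDisjoint, Set.union_inter_distrib_right]
    exact measure_union_null h0.2 h1
  have h3 : ν.real (({ζ | ζ 0 = Label.s} ∪ {ζ | ζ 1 = Label.s}) ∪ {ζ | ζ 2 = Label.s}) ≤ 1 :=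
    measureReal_le_one
  rw [hd2, hd1, hreal 1, hreal 2] at h3
  linarith

/-- With `e` the exponential, the gap at this point is `e / 2 * (1 - f * (2 + e))`, which is
positive since `e < 1` and `f ≤ 1 / 3`. -/
theorem transitionGap_ne_zero {f : ℝ} (hf0 : 0 ≤ f) (hf : f ≤ 1 / 3) :
    transitionGap f (1 / 2 + f / 2) ≠ 0 := by
  intro h
  rw [transitionGap] at h
  have h1 : Real.exp (-2 * (1 / 2 + f / 2)) < 1 := Real.exp_lt_one_iff.2 (by linarith)
  have h2 : 0 < Real.exp (-2 * (1 / 2 + f / 2)) := Real.exp_pos _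
  generalize Real.exp (-2 * (1 / 2 + f / 2)) = e at *
  have h3 : e * (1 - f * (2 + e)) = 0 := by linarith
  have h4 : 0 < 1 - f * (2 + e) := by nlinarith
  have := mul_pos h2 h4
  linarith

end Sandpile

/-! ### The main theorem -/

theorem mainTheorem2 (ν : MeasureTheory.Measure (ℤ → Sandpile.Label))
    [MeasureTheory.IsProbabilityMeasure ν]
    (hν : Ergodic Sandpile.shift ν)
    (hdir : Sandpile.IsDirected ν)
    (hres : Sandpile.IsRestricted ν) :
    ∃ ρs ρtr : ℝ,
      (∀ μ : MeasureTheory.Measure (ℕ → Fin 2), MeasureTheory.IsProbabilityMeasure μ →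
        Sandpile.IsStationaryDensity μ ν ρs) ∧
      ρs = 1 - Sandpile.directedFraction ν / 2 ∧
      Sandpile.IsTransitionDensity ν ρtr ∧
      (∀ ρ : ℝ,
        (0 ≤ ρ ∧ ρ - 1 / 2 * (1 - Real.exp (-2 * ρ)) =
          (1 - Sandpile.directedFraction ν) / 2 * (1 + Real.exp (-2 * ρ)) ^ 2) ↔ ρ = ρtr) ∧
      ρs ≠ ρtr := by
  have hf0 : 0 ≤ ν.real {ζ | ζ 0 = Sandpile.Label.s} := measureReal_nonneg
  have hf3 := Sandpile.real_label_s_le hν.toMeasurePreserving hres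
  have hf := Sandpile.real_label_s (ν := ν)
  obtain ⟨ρ, hρ0, hρ⟩ := Sandpile.exists_transitionGap_eq_zero hf0 (by linarith)
  refine ⟨1 / 2 + ν.real {ζ | ζ 0 = Sandpile.Label.s} / 2, ρ, fun μ _ =>
    Sandpile.isStationaryDensity hν.toMeasurePreserving hdir hres μ, by linarith,
    Sandpile.isTransitionDensity_of_transitionGap hν hdir hres hρ0 hρ, fun σ => ?_, ?_⟩
  · rw [← hf, ← sub_eq_zero]
    change 0 ≤ σ ∧ Sandpile.transitionGap _ σ = 0 ↔ σ = ρ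
    constructor
    · rintro ⟨hσ0, hσ⟩
      rcases lt_trichotomy σ ρ with h | h | h
      · have := Sandpile.transitionGap_lt hf0 hσ0 h
        linarith
      · exact h
      · have := Sandpile.transitionGap_lt hf0 hρ0 h
        linarith
    · rintro rfl
      exact ⟨hρ0, hρ⟩
  · rintro rfl
    exact Sandpile.transitionGap_ne_zero hf0 hf3 hρ
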